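/- Let ordinary variables $x,y,z,\dots$ and continuation variables $k,l,\dots$ be two disjoint countably infinite sorts. The terms of the \emph{call-by-value catch/throw calculus} are given by $$M ::= x \mid \lambda x.\,M \mid M\,M \mid M[x:=M] \mid \varepsilon k.\,M \mid \mathsf{throw}\,k\,M,$$ where $\lambda x.\,M$ binds $x$ in $M$, the construct $L[x:=M]$ (that is, "let $x=M$ in $L$") binds $x$ in $L$, and $\varepsilon k.\,M$ binds $k$ in $M$. Substitution is written with braces, and write $x\notin M$, $k\notin M$ for "not free in $M$". Terms are identified up to $\alpha$-conversion and up to the congruence generated by the equality axioms $$L[x:=(M[y:=N])]=(L[x:=M])[y:=N]\ \ (y\notin L),$$ $$(\varepsilon k.\,M)[x:=N]=\varepsilon k.\,(M[x:=N])\ \ (k\notin N),\qquad (\mathsf{throw}\,k\,M)[x:=N]=\mathsf{throw}\,k\,(M[x:=N]).$$ A value $V$ is a variable or a $\lambda$-abstraction. One-step reduction $\to$ is the closure, under all term constructors and modulo the above identification, of the rules ($z$ fresh) $$NM\to (zM)[z:=N]\ (N\text{ a non-value}),\qquad VN\to (Vz)[z:=N]\ (V\text{ a value},\ N\text{ a non-value}),$$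 $$(\lambda x.\,M)V\to M[x:=V],\qquad M[x:=V]\to M\{V/x\}\qquad (V\text{ a value}),$$ $$\lambda x.\,Vx\to V\ (V\text{ a value},\ x\notin V),\qquad x[x:=M]\to M,$$ $$\varepsilon k.\,M\to M\ (k\notin M),\qquad \varepsilon k.\,\mathsf{throw}\,k\,M\to\varepsilon k.\,M,$$ $$M[x:=\mathsf{throw}\,k\,N]\to \mathsf{throw}\,k\,N,\qquad \mathsf{throw}\,l\,(\mathsf{throw}\,k\,N)\to\mathsf{throw}\,k\,N,$$ $$M[x:=\varepsilon k.\,N]\to\varepsilon k.\,M[x:=N\{\mathsf{throw}\,k\,\square\mapsto\mathsf{throw}\,k\,(M[x:=\square])\}]\ (k\notin M),$$ $$\mathsf{throw}\,l\,(\varepsilon k.\,M)\to\mathsf{throw}\,l\,(M\{l/k\}),\qquad \varepsilon l.\,\varepsilon k.\,M\to\varepsilon l.\,M\{l/k\},$$ where the structural substitution $\{\mathsf{throw}\,k\,\square\mapsto\cdots\}$ recursively replaces every free $\mathsf{throw}\,k\,Q$, all substitutions are capture-avoiding, and $\{l/k\}$ replaces the free occurrences of $k$ by $l$. Let $\to^*$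 be the reflexive transitive closure of $\to$, and let $M_1=M_2$ mean that $M_1,M_2$ are related by the smallest congruence containing the equality axioms and the reduction rules. \textbf{Theorem.} The call-by-value catch/throw calculus has the Church--Rosser property: whenever $M_1=M_2$, there is a term $P$ with $M_1\to^* P$ and $M_2\to^* P$. -/

import Mathlib

/-- Raw terms of the call-by-value catch/throw calculus, up to `α`-conversion, in de Bruijn notation.
Ordinary variables and continuation variables have separate index spaces. -/
inductive CTTerm : Type
  /-- an ordinary variable -/
  | var (x : ℕ) : CTTerm
  /-- `λx. M`; binds the ordinary index `0` in `M` -/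
  | lam (M : CTTerm) : CTTerm
  /-- `M N` -/
  | app (M N : CTTerm) : CTTerm
  /-- `L[x := M]`, i.e. "let `x = M` in `L`"; binds the ordinary index `0` in `L`, not in `M` -/
  | letIn (L M : CTTerm) : CTTerm
  /-- `εk. M`; binds the continuation index `0` in `M` -/
  | eps (M : CTTerm) : CTTerm
  /-- `throw k M` -/
  | throw (k : ℕ) (M : CTTerm) : CTTerm

namespace CTTerm

/-- Lift a renaming of indices under one binder. -/
def up (f : ℕ → ℕ) : ℕ → ℕ
  | 0 => 0
  | n + 1 => f n + 1

/-- Rename the free ordinary variables by `f` and the free continuation variables by `g`. -/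
def rename : (ℕ → ℕ) → (ℕ → ℕ) → CTTerm → CTTerm
  | f, _, var x => var (f x)
  | f, g, lam M => lam (rename (up f) g M)
  | f, g, app M N => app (rename f g M) (rename f g N)
  | f, g, letIn L M => letIn (rename (up f) g L) (rename f g M)
  | f, g, eps M => eps (rename f (up g) M)
  | f, g, throw k M => throw (g k) (rename f g M)

/-- Weakening by a fresh ordinary variable (which gets index `0`). -/
def shift (M : CTTerm) : CTTerm := rename Nat.succ id M

/-- For a term under one ordinary binder: weakening by a fresh ordinary variable that is bound
just outside that binder (it gets index `1`, and the innermost bound variable keeps index `0`). -/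
def shiftUnder (M : CTTerm) : CTTerm := rename (up Nat.succ) id M

/-- Weakening by a fresh continuation variable (which gets index `0`). -/
def cshift (M : CTTerm) : CTTerm := rename id Nat.succ M

/-- `M{l/k}` where `k` is the continuation variable of index `0` and `l` is given in the context
outside the binder of `k`; the other continuation indices go down by one. -/
def cinst (l : ℕ) (M : CTTerm) : CTTerm :=
  rename id (fun n => match n with
    | 0 => l
    | n + 1 => n) M

/-- Lift a substitution under an ordinary binder. -/
def upSubst (s : ℕ → CTTerm) : ℕ → CTTerm
  | 0 => var 0
  | n + 1 => shift (s n)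

/-- Simultaneous capture-avoiding substitution for the free ordinary variables. -/
def subst : (ℕ → CTTerm) → CTTerm → CTTerm
  | s, var x => s x
  | s, lam M => lam (subst (upSubst s) M)
  | s, app M N => app (subst s M) (subst s N)
  | s, letIn L M => letIn (subst (upSubst s) L) (subst s M)
  | s, eps M => eps (subst (fun n => cshift (s n)) M)
  | s, throw k M => throw k (subst s M)

/-- `M{V/x}` where `x` is the ordinary variable of index `0`. -/
def inst (V M : CTTerm) : CTTerm :=
  subst (fun n => match n with
    | 0 => V
    | n + 1 => var n) M

/-- Structural substitution `N{throw k □ ↦ throw k (L[x := □])}`, applied recursively and avoiding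
capture; the ordinary index `0` of `L` is the variable `x` bound by the let. -/
def structSubst : ℕ → CTTerm → CTTerm → CTTerm
  | _, _, var x => var x
  | k, L, lam N => lam (structSubst k (shiftUnder L) N)
  | k, L, app M N => app (structSubst k L M) (structSubst k L N)
  | k, L, letIn M N => letIn (structSubst k (shiftUnder L) M) (structSubst k L N)
  | k, L, eps N => eps (structSubst (k + 1) (cshift L) N)
  | k, L, throw j N =>
      if j = k then throw k (letIn L (structSubst k L N)) else throw j (structSubst k L N)

/-- A value is a variable or a lambda abstraction. -/
inductive IsValue : CTTerm → Prop
  | var (x : ℕ) : IsValue (var x)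
  | lam (M : CTTerm) : IsValue (lam M)

/-- The equality axioms. -/
inductive EqAxiom : CTTerm → CTTerm → Prop
  /-- `L[x := M[y := N]] = (L[x := M])[y := N]` if `y ∉ L` -/
  | assoc (L M N : CTTerm) :
      EqAxiom (letIn L (letIn M N)) (letIn (letIn (shiftUnder L) M) N)
  /-- `(εk. M)[x := N] = εk. (M[x := N])` if `k ∉ N` -/
  | epsLet (M N : CTTerm) : EqAxiom (letIn (eps M) N) (eps (letIn M (cshift N)))
  /-- `(throw k M)[x := N] = throw k (M[x := N])` -/
  | throwLet (k : ℕ) (M N : CTTerm) : EqAxiom (letIn (throw k M) N) (throw k (letIn M N))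

/-- The reduction rules (at the root). -/
inductive Rule : CTTerm → CTTerm → Prop
  /-- `N M → (z M)[z := N]`, `N` a non-value, `z` fresh -/
  | ad₁ (N M : CTTerm) : ¬ IsValue N → Rule (app N M) (letIn (app (var 0) (shift M)) N)
  /-- `V N → (V z)[z := N]`, `V` a value, `N` a non-value, `z` fresh -/
  | ad₂ (V N : CTTerm) : IsValue V → ¬ IsValue N →
      Rule (app V N) (letIn (app (shift V) (var 0)) N)
  /-- `(λx. M) V → M[x := V]` -/
  | betaLam (M V : CTTerm) : IsValue V → Rule (app (lam M) V) (letIn M V)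
  /-- `M[x := V] → M{V/x}` -/
  | betaLet (M V : CTTerm) : IsValue V → Rule (letIn M V) (inst V M)
  /-- `λx. V x → V` if `x ∉ V` -/
  | etaLam (V : CTTerm) : IsValue V → Rule (lam (app (shift V) (var 0))) V
  /-- `x[x := M] → M` -/
  | etaLet (M : CTTerm) : Rule (letIn (var 0) M) M
  /-- `εδ. M → M` if `δ ∉ M` -/
  | epsDummy (M : CTTerm) : Rule (eps (cshift M)) M
  /-- `εk. throw k M → εk. M` -/
  | epsThrow (M : CTTerm) : Rule (eps (throw 0 M)) (eps M)
  /-- `M[x := throw k N] → throw k N` -/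
  | letThrow (M : CTTerm) (k : ℕ) (N : CTTerm) : Rule (letIn M (throw k N)) (throw k N)
  /-- `throw l (throw k N) → throw k N` -/
  | throwThrow (l k : ℕ) (N : CTTerm) : Rule (throw l (throw k N)) (throw k N)
  /-- `M[x := εk. N] → εk. M[x := N{throw k □ ↦ throw k (M[x := □])}]`, where `k ∉ M` -/
  | letEps (M N : CTTerm) :
      Rule (letIn M (eps N)) (eps (letIn (cshift M) (structSubst 0 (cshift M) N)))
  /-- `throw l (εk. M) → throw l (M{l/k})` -/
  | throwEps (l : ℕ) (M : CTTerm) : Rule (throw l (eps M)) (throw l (cinst l M))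
  /-- `εl. εk. M → εl. M{l/k}` -/
  | epsEps (M : CTTerm) : Rule (eps (eps M)) (eps (cinst 0 M))

/-- The smallest congruence relation containing `R`. -/
inductive CongrGen (R : CTTerm → CTTerm → Prop) : CTTerm → CTTerm → Prop
  | base {M N : CTTerm} : R M N → CongrGen R M N
  | refl (M : CTTerm) : CongrGen R M M
  | symm {M N : CTTerm} : CongrGen R M N → CongrGen R N M
  | trans {M N P : CTTerm} : CongrGen R M N → CongrGen R N P → CongrGen R M P
  | lam {M M' : CTTerm} : CongrGen R M M' → CongrGen R (lam M) (lam M')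
  | app {M M' N N' : CTTerm} : CongrGen R M M' → CongrGen R N N' →
      CongrGen R (app M N) (app M' N')
  | letIn {L L' M M' : CTTerm} : CongrGen R L L' → CongrGen R M M' →
      CongrGen R (letIn L M) (letIn L' M')
  | eps {M M' : CTTerm} : CongrGen R M M' → CongrGen R (eps M) (eps M')
  | throw (k : ℕ) {M M' : CTTerm} : CongrGen R M M' → CongrGen R (throw k M) (throw k M')

/-- One application of a reduction rule, at an arbitrary position of a raw term. -/
inductive RawStep : CTTerm → CTTerm → Prop
  | rule {M N : CTTerm} : Rule M N → RawStep M N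
  | lam {M M' : CTTerm} : RawStep M M' → RawStep (lam M) (lam M')
  | appLeft {M M' : CTTerm} (N : CTTerm) : RawStep M M' → RawStep (app M N) (app M' N)
  | appRight (M : CTTerm) {N N' : CTTerm} : RawStep N N' → RawStep (app M N) (app M N')
  | letLeft {L L' : CTTerm} (M : CTTerm) : RawStep L L' → RawStep (letIn L M) (letIn L' M)
  | letRight (L : CTTerm) {M M' : CTTerm} : RawStep M M' → RawStep (letIn L M) (letIn L M')
  | eps {M M' : CTTerm} : RawStep M M' → RawStep (eps M) (eps M')
  | throw (k : ℕ) {M M' : CTTerm} : RawStep M M' → RawStep (throw k M) (throw k M')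

/-- Identity of terms: the congruence generated by the equality axioms. -/
def structSetoid : Setoid CTTerm where
  r := CongrGen EqAxiom
  iseqv := ⟨CongrGen.refl, CongrGen.symm, CongrGen.trans⟩

/-- Convertibility: the congruence generated by the equality axioms and the reduction rules. -/
def Conv : CTTerm → CTTerm → Prop := CongrGen (fun M N => EqAxiom M N ∨ Rule M N)

end CTTerm

/-- The terms of the call-by-value catch/throw calculus: raw terms modulo the equality axioms. -/
def CTClass : Type := Quotient CTTerm.structSetoid

namespace CTClass

/-- The term represented by a raw term. -/
def mk (M : CTTerm) : CTClass := Quotient.mk CTTerm.structSetoid M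

/-- One-step reduction between terms modulo the equality axioms: some representatives are related
by one application of a reduction rule. -/
def Step (A B : CTClass) : Prop :=
  ∃ M N : CTTerm, mk M = A ∧ mk N = B ∧ CTTerm.RawStep M N

/-- Reduction in zero or more steps. -/
def Steps : CTClass → CTClass → Prop := Relation.ReflTransGen Step

end CTClass

/-! Confluence is pulled back along a continuation-passing translation. The target calculus has only
two redexes, call-by-value beta and eta for functions that take an argument and a continuation, and
its parallel reduction has the diamond property (`Tm.Par.diamond`).

The translation `Tm.cps` turns the equality axioms and every rule except `betaLam` and `etaLam` into
identities. These two become one beta and one eta step (`Tm.cps_eqAxiom`, `Tm.cps_rule`). So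
convertible terms have translations with a common reduct `Q` (`Tm.cv_of_conv`).

An inverse translation `CTTerm.full` brings `Q` back. Every source term `M` reduces to `full (cps
M)` (`CTTerm.red_full_cps`), and a target reduction `P →* Q` yields a source reduction `full P →*
full Q` (`CTTerm.Red.full_of_par`). Hence both source terms reduce to `full Q`.

The delicate point is the second fact: substitution for continuations must become structural
substitution (`body_bsub`), and an `ε` produced by a contraction may have to be merged with the
surrounding `ε` or `throw` (`Simulates`). -/

/-- Terms of the continuation-passing target calculus; `Tm true` are the values and `Tm false` the
commands. `lam` binds an ordinary and a continuation variable, `bind V W P` is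
"let `x = V W` in `P`", and `ret k V` passes `V` to the continuation `k`. -/
inductive Tm : Bool → Type
  | var (x : ℕ) : Tm true
  | lam (P : Tm false) : Tm true
  | ret (k : ℕ) (V : Tm true) : Tm false
  | bind (V W : Tm true) (P : Tm false) : Tm false

/-! ### Substitution algebra of the target calculus. -/

namespace Tm
open CTTerm (up)

theorem up_id : up id = id := by
  funext n; cases n <;> rfl

theorem up_comp (f g : ℕ → ℕ) : up (f ∘ g) = up f ∘ up g := by
  funext n; cases n <;> rfl

theorem up_injective {f : ℕ → ℕ} (hf : f.Injective) : (up f).Injective := by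
  intro a b h
  cases a <;> cases b <;> simp [up] at h ⊢
  exact hf h

/-- Renaming of ordinary and continuation variables. -/
def ren : {b : Bool} → (ℕ → ℕ) → (ℕ → ℕ) → Tm b → Tm b
  | _, f, _, var x => var (f x)
  | _, f, g, lam P => lam (ren (up f) (up g) P)
  | _, f, g, ret k V => ret (g k) (ren f g V)
  | _, f, g, bind V W P => bind (ren f g V) (ren f g W) (ren (up f) g P)

/-- Lift a value substitution under an ordinary binder. -/
def upV (s : ℕ → Tm true) : ℕ → Tm true
  | 0 => var 0
  | n + 1 => ren Nat.succ id (s n)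

/-- Lift a value substitution under `lam`. -/
def upL (s : ℕ → Tm true) : ℕ → Tm true
  | 0 => var 0
  | n + 1 => ren Nat.succ Nat.succ (s n)

/-- Substitution of values for ordinary variables and renaming of continuation variables. -/
def vsub : {b : Bool} → (ℕ → Tm true) → (ℕ → ℕ) → Tm b → Tm b
  | _, s, _, var x => s x
  | _, s, g, lam P => lam (vsub (upL s) (up g) P)
  | _, s, g, ret k V => ret (g k) (vsub s g V)
  | _, s, g, bind V W P => bind (vsub s g V) (vsub s g W) (vsub (upV s) g P)

/-- The substitution that replaces index `0` by `V` and lowers the other indices. -/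
def scons (V : Tm true) : ℕ → Tm true
  | 0 => V
  | n + 1 => var n

/-- Lift a continuation substitution under an ordinary binder. -/
def upK (t : ℕ → Tm false) (k : ℕ) : Tm false := ren (up Nat.succ) id (t k)

/-- Lift a continuation substitution under `lam`. -/
def upKL (t : ℕ → Tm false) : ℕ → Tm false
  | 0 => ret 0 (var 0)
  | k + 1 => ren (up Nat.succ) Nat.succ (t k)

/-- Simultaneous substitution of values for ordinary variables and of continuations (commands with
a distinguished ordinary variable of index `0`) for continuation variables. -/
def bsub : {b : Bool} → (ℕ → Tm true) → (ℕ → Tm false) → Tm b → Tm b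
  | _, s, _, var x => s x
  | _, s, t, lam P => lam (bsub (upL s) (upKL t) P)
  | _, s, t, ret k V => vsub (scons (bsub s t V)) id (t k)
  | _, s, t, bind V W P => bind (bsub s t V) (bsub s t W) (bsub (upV s) (upK t) P)

theorem ren_id {b : Bool} (M : Tm b) : ren id id M = M := by
  induction M <;> simp_all [ren, up_id]

theorem ren_ren {b : Bool} (f g f' g' : ℕ → ℕ) (M : Tm b) :
    ren f g (ren f' g' M) = ren (f ∘ f') (g ∘ g') M := by
  induction M generalizing f g f' g' <;> simp_all [ren, up_comp]

theorem vsub_ren {b : Bool} (s : ℕ → Tm true) (g f' g' : ℕ → ℕ) (M : Tm b) :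
    vsub s g (ren f' g' M) = vsub (s ∘ f') (g ∘ g') M := by
  induction M generalizing s g f' g' with
  | var x => rfl
  | lam P ih =>
    simp only [ren, vsub, ih, up_comp]
    congr 2; funext n; cases n <;> rfl
  | ret k V ih => simp [ren, vsub, ih]
  | bind V W P ih1 ih2 ih3 =>
    simp only [ren, vsub, ih1, ih2, ih3]
    congr 2; funext n; cases n <;> rfl

theorem ren_vsub {b : Bool} (f g : ℕ → ℕ) (s : ℕ → Tm true) (g' : ℕ → ℕ) (M : Tm b) :
    ren f g (vsub s g' M) = vsub (fun n => ren f g (s n)) (g ∘ g') M := by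
  induction M generalizing s f g g' with
  | var x => rfl
  | lam P ih =>
    simp only [ren, vsub, ih, up_comp]
    congr 2; funext n; cases n
    · rfl
    · simp only [upL, ren_ren]; rfl
  | ret k V ih => simp [ren, vsub, ih]
  | bind V W P ih1 ih2 ih3 =>
    simp only [ren, vsub, ih1, ih2, ih3]
    congr 2; funext n; cases n
    · rfl
    · simp only [upV, ren_ren]; rfl

theorem vsub_vsub {b : Bool} (s : ℕ → Tm true) (g : ℕ → ℕ) (s' : ℕ → Tm true) (g' : ℕ → ℕ)
    (M : Tm b) : vsub s g (vsub s' g' M) = vsub (fun n => vsub s g (s' n)) (g ∘ g') M := by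
  induction M generalizing s g s' g' with
  | var x => rfl
  | lam P ih =>
    simp only [vsub, ih, up_comp]
    congr 2; funext n; cases n
    · rfl
    · simp only [upL, ren_vsub, vsub_ren]; rfl
  | ret k V ih => simp [vsub, ih]
  | bind V W P ih1 ih2 ih3 =>
    simp only [vsub, ih1, ih2, ih3]
    congr 2; funext n; cases n
    · rfl
    · simp only [upV, ren_vsub, vsub_ren]; rfl

theorem upV_var (f : ℕ → ℕ) : upV (fun n => var (f n)) = fun n => var (up f n) := by
  funext n; cases n <;> rfl

theorem upL_var (f : ℕ → ℕ) : upL (fun n => var (f n)) = fun n => var (up f n) := by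
  funext n; cases n <;> rfl

theorem vsub_var {b : Bool} (f g : ℕ → ℕ) (M : Tm b) :
    vsub (fun n => var (f n)) g M = ren f g M := by
  induction M generalizing f g <;> simp_all [vsub, ren, upV_var, upL_var]

theorem vsub_id {b : Bool} (M : Tm b) : vsub var id M = M :=
  (vsub_var id id M).trans (ren_id M)

theorem upV_id : upV var = var := upV_var id |>.trans (by simp [up_id])
theorem upL_id : upL var = var := upL_var id |>.trans (by simp [up_id])

theorem scons_ren_zero {b : Bool} (V : Tm true) (g : ℕ → ℕ) (M : Tm b) :
    vsub (scons V) id (ren Nat.succ g M) = ren id g M := by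
  rw [vsub_ren, ← vsub_var]; rfl

/-- Continuation variables as continuations. -/
def kvar (g : ℕ → ℕ) (k : ℕ) : Tm false := ret (g k) (var 0)

theorem upK_kvar (g : ℕ → ℕ) : upK (kvar g) = kvar g := rfl

theorem upKL_kvar (g : ℕ → ℕ) : upKL (kvar g) = kvar (up g) := by
  funext k; cases k <;> rfl

/-- Thus `vsub` is a special case of `bsub`. It is defined separately because the `ret` case of
`bsub` substitutes into `t k`, which is not a subterm. -/
theorem bsub_kvar {b : Bool} (s : ℕ → Tm true) (g : ℕ → ℕ) (M : Tm b) :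
    bsub s (kvar g) M = vsub s g M := by
  induction M generalizing s g with
  | var x => rfl
  | lam P ih => simp [bsub, vsub, upKL_kvar, ih]
  | ret k V ih => simp [bsub, vsub, ih, kvar, scons]
  | bind V W P ih1 ih2 ih3 => simp [bsub, vsub, upK_kvar, ih1, ih2, ih3]

theorem bsub_id {b : Bool} (M : Tm b) : bsub var (kvar id) M = M := by
  rw [bsub_kvar, vsub_id]

theorem bsub_ren {b : Bool} (s : ℕ → Tm true) (t : ℕ → Tm false) (f g : ℕ → ℕ) (M : Tm b) :
    bsub s t (ren f g M) = bsub (s ∘ f) (t ∘ g) M := by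
  induction M generalizing s t f g with
  | var x => rfl
  | lam P ih =>
    simp only [ren, bsub, ih]
    congr 2 <;> funext n <;> cases n <;> rfl
  | ret k V ih => simp [ren, bsub, ih]
  | bind V W P ih1 ih2 ih3 =>
    simp only [ren, bsub, ih1, ih2, ih3]
    congr 2; funext n; cases n <;> rfl

/-- The continuations `t k` carry a distinguished ordinary variable of index `0`, so the outer
substitution reaches them in the lifted form `upV s`. -/
theorem vsub_bsub {b : Bool} (s : ℕ → Tm true) (g : ℕ → ℕ) (s' : ℕ → Tm true) (t : ℕ → Tm false)
    (M : Tm b) :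
    vsub s g (bsub s' t M) = bsub (fun n => vsub s g (s' n)) (fun k => vsub (upV s) g (t k)) M := by
  induction M generalizing s g s' t with
  | var x => rfl
  | lam P ih =>
    simp only [vsub, bsub, ih]
    congr 2 <;> funext n <;> cases n
    · rfl
    · simp only [upL, ren_vsub, vsub_ren]; rfl
    · rfl
    · simp only [upKL, ren_vsub, vsub_ren]
      congr 1; funext n; cases n
      · rfl
      · simp only [Function.comp, upV, upL, up, ren_ren]; rfl
  | ret k V ih =>
    simp only [bsub, vsub_vsub, ← ih]
    congr 1; funext n; cases n
    · rfl
    · simp only [scons, upV, vsub, scons_ren_zero, ren_id]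
  | bind V W P ih1 ih2 ih3 =>
    simp only [vsub, bsub, ih1, ih2, ih3]
    congr 2 <;> funext n
    · cases n
      · rfl
      · simp only [upV, ren_vsub, vsub_ren]; rfl
    · simp only [upK, ren_vsub, vsub_ren]
      congr 1; funext n; cases n
      · rfl
      · simp only [Function.comp, upV, up, ren_ren]; rfl

theorem ren_bsub {b : Bool} (f g : ℕ → ℕ) (s : ℕ → Tm true) (t : ℕ → Tm false) (M : Tm b) :
    ren f g (bsub s t M) = bsub (fun n => ren f g (s n)) (fun k => ren (up f) g (t k)) M := by
  simp only [← vsub_var, vsub_bsub, upV_var]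

theorem bsub_vsub {b : Bool} (s : ℕ → Tm true) (t : ℕ → Tm false) (s' : ℕ → Tm true) (g : ℕ → ℕ)
    (M : Tm b) :
    bsub s t (vsub s' g M) = bsub (fun n => bsub s t (s' n)) (t ∘ g) M := by
  induction M generalizing s t s' g with
  | var x => rfl
  | lam P ih =>
    simp only [vsub, bsub, ih]
    congr 2 <;> funext n <;> cases n
    · rfl
    · simp only [upL, bsub_ren, ren_bsub]; rfl
    · rfl
    · rfl
  | ret k V ih => simp [vsub, bsub, ih]
  | bind V W P ih1 ih2 ih3 =>
    simp only [vsub, bsub, ih1, ih2, ih3]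
    congr 2 ; funext n; cases n
    · rfl
    · simp only [upV, bsub_ren, ren_bsub]; rfl

/-- Associativity of substitution. It later gives the let-associativity axiom and the structural
substitution rule. -/
theorem bsub_bsub {b : Bool} (s : ℕ → Tm true) (t : ℕ → Tm false) (s' : ℕ → Tm true)
    (t' : ℕ → Tm false) (M : Tm b) :
    bsub s t (bsub s' t' M) =
      bsub (fun n => bsub s t (s' n)) (fun k => bsub (upV s) (upK t) (t' k)) M := by
  induction M generalizing s t s' t' with
  | var x => rfl
  | lam P ih =>
    simp only [bsub, ih]
    congr 2 <;> funext n <;> cases n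
    · rfl
    · simp only [upL, ren_bsub, bsub_ren]; rfl
    · rfl
    · simp only [upKL, ren_bsub, bsub_ren]
      congr 1 <;> funext n
      · cases n
        · rfl
        · simp only [Function.comp, upV, upL, up, ren_ren]; rfl
      · simp only [Function.comp, upK, upKL, ren_ren]
        (congr 1 <;> funext n); all_goals cases n <;> rfl
  | ret k V ih =>
    simp only [bsub, bsub_vsub, vsub_bsub, ← ih]
    congr 1 <;> funext n
    · cases n
      · rfl
      · simp only [scons, upV, bsub, scons_ren_zero, ren_id]
    · simp only [upK, vsub_ren]
      conv_lhs => rw [Function.comp, id, ← vsub_id (t n)]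
      congr 1; funext n; cases n <;> rfl
  | bind V W P ih1 ih2 ih3 =>
    simp only [bsub, ih1, ih2, ih3]
    congr 2 <;> funext n
    · cases n
      · rfl
      · simp only [upV, ren_bsub, bsub_ren]; rfl
    · simp only [upK, ren_bsub, bsub_ren]
      congr 1 <;> funext n
      · cases n
        · rfl
        · simp only [Function.comp, upV, up, ren_ren]; rfl
      · simp only [Function.comp, upK, ren_ren]
        (congr 1 <;> funext n); all_goals cases n <;> rfl

/-! ### Parallel reduction and the diamond property. -/

/-- The continuation substitution that replaces index `0` by `P` and lowers the other indices. -/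
def kcons (P : Tm false) : ℕ → Tm false
  | 0 => P
  | k + 1 => ret k (var 0)

/-- The contractum of `bind (lam Q) V P`. -/
def binst (Q : Tm false) (V : Tm true) (P : Tm false) : Tm false := bsub (scons V) (kcons P) Q

/-- The eta-expansion of a value. -/
def etaExp (V : Tm true) : Tm true :=
  lam (bind (ren Nat.succ Nat.succ V) (var 0) (ret 0 (var 0)))

/-- Parallel reduction. -/
inductive Par : {b : Bool} → Tm b → Tm b → Prop
  | var (x : ℕ) : Par (var x) (var x)
  | lam {P P' : Tm false} : Par P P' → Par (lam P) (lam P')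
  | ret (k : ℕ) {V V' : Tm true} : Par V V' → Par (ret k V) (ret k V')
  | bind {V V' W W' : Tm true} {P P' : Tm false} : Par V V' → Par W W' → Par P P' →
      Par (bind V W P) (bind V' W' P')
  | beta {Q Q' : Tm false} {V V' : Tm true} {P P' : Tm false} : Par Q Q' → Par V V' → Par P P' →
      Par (Tm.bind (Tm.lam Q) V P) (binst Q' V' P')
  | eta {V V' : Tm true} : Par V V' → Par (etaExp V) V'

theorem Par.refl {b : Bool} (M : Tm b) : Par M M := by
  induction M with
  | var x => exact .var x
  | lam P ih => exact .lam ih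
  | ret k V ih => exact .ret k ih
  | bind V W P h1 h2 h3 => exact .bind h1 h2 h3

theorem vsub_binst (s : ℕ → Tm true) (g : ℕ → ℕ) (Q : Tm false) (V : Tm true) (P : Tm false) :
    vsub s g (binst Q V P) = binst (vsub (upL s) (up g) Q) (vsub s g V) (vsub (upV s) g P) := by
  simp only [binst, vsub_bsub, bsub_vsub]
  congr 1 <;> funext n <;> cases n
  · rfl
  · simp only [upL, bsub_ren, scons, vsub]
    exact ((bsub_kvar var id (s _)).trans (vsub_id _)).symm
  · rfl
  · rfl

theorem ren_binst (f g : ℕ → ℕ) (Q : Tm false) (V : Tm true) (P : Tm false) :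
    ren f g (binst Q V P) = binst (ren (up f) (up g) Q) (ren f g V) (ren (up f) g P) := by
  simp only [← vsub_var, vsub_binst, upV_var, upL_var]

theorem bsub_binst (s : ℕ → Tm true) (t : ℕ → Tm false) (Q : Tm false) (V : Tm true)
    (P : Tm false) :
    bsub s t (binst Q V P) =
      binst (bsub (upL s) (upKL t) Q) (bsub s t V) (bsub (upV s) (upK t) P) := by
  simp only [binst, bsub_bsub]
  congr 1 <;> funext n <;> cases n
  · rfl
  · simp only [upL, bsub_ren, scons, bsub]
    exact (bsub_id (s _)).symm
  · simp only [kcons, upKL, bsub, upK]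
    rw [vsub_ren]
    conv_lhs => rw [← vsub_id (bsub _ _ _)]
    congr 1; funext n; cases n <;> rfl
  · simp only [kcons, upKL, bsub, upK, bsub_ren, vsub_ren, upV]
    rw [← bsub_kvar]
    congr 1; funext n; cases n <;> rfl

theorem vsub_etaExp (s : ℕ → Tm true) (g : ℕ → ℕ) (V : Tm true) :
    vsub s g (etaExp V) = etaExp (vsub s g V) := by
  simp only [etaExp, vsub, vsub_ren, ren_vsub]; rfl

theorem ren_etaExp (f g : ℕ → ℕ) (V : Tm true) : ren f g (etaExp V) = etaExp (ren f g V) := by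
  simp only [← vsub_var, vsub_etaExp]

theorem bsub_etaExp (s : ℕ → Tm true) (t : ℕ → Tm false) (V : Tm true) :
    bsub s t (etaExp V) = etaExp (bsub s t V) := by
  simp only [etaExp, bsub, bsub_ren, ren_bsub]; rfl

theorem Par.ren {b : Bool} {M M' : Tm b} (h : Par M M') (f g : ℕ → ℕ) :
    Par (ren f g M) (ren f g M') := by
  induction h generalizing f g with
  | var x => exact .refl _
  | lam _ ih => exact .lam (ih _ _)
  | ret k _ ih => exact .ret _ (ih _ _)
  | bind _ _ _ h1 h2 h3 => exact .bind (h1 _ _) (h2 _ _) (h3 _ _)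
  | beta _ _ _ h1 h2 h3 => rw [ren_binst]; exact .beta (h1 _ _) (h2 _ _) (h3 _ _)
  | eta _ ih => rw [ren_etaExp]; exact .eta (ih _ _)

theorem Par.upV {s s' : ℕ → Tm true} (h : ∀ n, Par (s n) (s' n)) (n : ℕ) :
    Par (upV s n) (upV s' n) := by
  cases n with
  | zero => exact .refl _
  | succ n => exact (h n).ren _ _

theorem Par.upL {s s' : ℕ → Tm true} (h : ∀ n, Par (s n) (s' n)) (n : ℕ) :
    Par (upL s n) (upL s' n) := by
  cases n with
  | zero => exact .refl _
  | succ n => exact (h n).ren _ _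

theorem Par.upKL {t t' : ℕ → Tm false} (h : ∀ n, Par (t n) (t' n)) (n : ℕ) :
    Par (upKL t n) (upKL t' n) := by
  cases n with
  | zero => exact .refl _
  | succ n => exact (h n).ren _ _

theorem Par.vsub {b : Bool} {M M' : Tm b} (h : Par M M') {s s' : ℕ → Tm true}
    (hs : ∀ n, Par (s n) (s' n)) (g : ℕ → ℕ) : Par (vsub s g M) (vsub s' g M') := by
  induction h generalizing s s' g with
  | var x => exact hs x
  | lam _ ih => exact .lam (ih (Par.upL hs) _)
  | ret k _ ih => exact .ret _ (ih hs _)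
  | bind _ _ _ h1 h2 h3 => exact .bind (h1 hs _) (h2 hs _) (h3 (Par.upV hs) _)
  | beta _ _ _ h1 h2 h3 =>
    rw [vsub_binst]; exact .beta (h1 (Par.upL hs) _) (h2 hs _) (h3 (Par.upV hs) _)
  | eta _ ih => rw [vsub_etaExp]; exact .eta (ih hs _)

theorem Par.scons {V V' : Tm true} (h : Par V V') (n : ℕ) : Par (scons V n) (scons V' n) := by
  cases n with
  | zero => exact h
  | succ n => exact .refl _

theorem Par.kcons {P P' : Tm false} (h : Par P P') (n : ℕ) : Par (kcons P n) (kcons P' n) := by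
  cases n with
  | zero => exact h
  | succ n => exact .refl _

theorem Par.bsub {b : Bool} {M M' : Tm b} (h : Par M M') {s s' : ℕ → Tm true}
    {t t' : ℕ → Tm false} (hs : ∀ n, Par (s n) (s' n)) (ht : ∀ n, Par (t n) (t' n)) :
    Par (bsub s t M) (bsub s' t' M') := by
  induction h generalizing s s' t t' with
  | var x => exact hs x
  | lam _ ih => exact .lam (ih (Par.upL hs) (Par.upKL ht))
  | ret k _ ih => exact (ht k).vsub (Par.scons (ih hs ht)) _
  | bind _ _ _ h1 h2 h3 =>
    exact .bind (h1 hs ht) (h2 hs ht) (h3 (Par.upV hs) (fun n => (ht n).ren _ _))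
  | beta _ _ _ h1 h2 h3 =>
    rw [bsub_binst]
    exact .beta (h1 (Par.upL hs) (Par.upKL ht)) (h2 hs ht)
      (h3 (Par.upV hs) (fun n => (ht n).ren _ _))
  | eta _ ih => rw [bsub_etaExp]; exact .eta (ih hs ht)

theorem Par.binst {Q Q' : Tm false} {V V' : Tm true} {P P' : Tm false} (h1 : Par Q Q')
    (h2 : Par V V') (h3 : Par P P') : Par (binst Q V P) (binst Q' V' P') :=
  h1.bsub (Par.scons h2) (Par.kcons h3)

/-- Pullback squares of renamings on indices lift to terms. The instances needed are injectivity and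
the square of `up f` against `Nat.succ`, which recognises a weakened subterm of a renamed term. -/
theorem ren_pullback {b : Bool} (A B : Tm b) {f1 f2 f3 f4 g1 g2 g3 g4 : ℕ → ℕ}
    (hf : ∀ x y, f1 x = f2 y → ∃ z, x = f3 z ∧ y = f4 z)
    (hg : ∀ x y, g1 x = g2 y → ∃ z, x = g3 z ∧ y = g4 z) (h : ren f1 g1 A = ren f2 g2 B) :
    ∃ C, A = ren f3 g3 C ∧ B = ren f4 g4 C := by
  have hup : ∀ {f1 f2 f3 f4 : ℕ → ℕ}, (∀ x y, f1 x = f2 y → ∃ z, x = f3 z ∧ y = f4 z) →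
      ∀ x y, up f1 x = up f2 y → ∃ z, x = up f3 z ∧ y = up f4 z := by
    intro f1 f2 f3 f4 hf x y hxy
    cases x <;> cases y <;> simp [up] at hxy
    · exact ⟨0, rfl, rfl⟩
    · obtain ⟨z, rfl, rfl⟩ := hf _ _ hxy
      exact ⟨z + 1, rfl, rfl⟩
  induction A generalizing f1 f2 f3 f4 g1 g2 g3 g4 with
  | var x =>
    cases B with
    | var y =>
      obtain ⟨z, rfl, rfl⟩ := hf x y (by simpa [ren] using h)
      exact ⟨var z, rfl, rfl⟩
    | lam Q => simp [ren] at h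
  | lam P ih =>
    cases B with
    | var y => simp [ren] at h
    | lam Q =>
      obtain ⟨C, rfl, rfl⟩ := ih Q (hup hf) (hup hg) (by simpa [ren] using h)
      exact ⟨lam C, rfl, rfl⟩
  | ret k V ih =>
    cases B with
    | bind => simp [ren] at h
    | ret j W =>
      simp only [ren, ret.injEq] at h
      obtain ⟨C, rfl, rfl⟩ := ih W hf hg h.2
      obtain ⟨z, rfl, rfl⟩ := hg _ _ h.1
      exact ⟨ret z C, rfl, rfl⟩
  | bind V W P h1 h2 h3 =>
    cases B with
    | ret => simp [ren] at h
    | bind V' W' P' =>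
      simp only [ren, bind.injEq] at h
      obtain ⟨C1, rfl, rfl⟩ := h1 V' hf hg h.1
      obtain ⟨C2, rfl, rfl⟩ := h2 W' hf hg h.2.1
      obtain ⟨C3, rfl, rfl⟩ := h3 P' (hup hf) hg h.2.2
      exact ⟨bind C1 C2 C3, rfl, rfl⟩

theorem ren_injective {b : Bool} {f g : ℕ → ℕ} (hf : f.Injective) (hg : g.Injective) :
    Function.Injective (ren (b := b) f g) := by
  intro A B h
  obtain ⟨C, rfl, rfl⟩ := ren_pullback (f3 := id) (f4 := id) (g3 := id) (g4 := id) A B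
    (fun x y hxy => ⟨x, rfl, (hf hxy).symm⟩) (fun x y hxy => ⟨x, rfl, (hg hxy).symm⟩) h
  rfl

theorem up_succ_pullback (f : ℕ → ℕ) (x y : ℕ) (h : up f x = Nat.succ y) :
    ∃ z, x = Nat.succ z ∧ y = f z := by
  cases x with
  | zero => simp [up] at h
  | succ z => exact ⟨z, rfl, by simpa [up] using h.symm⟩

/-- The function part lies in the image of `up f` and in the image of weakening, so the pullback
exhibits it as a weakening already before the renaming. -/
theorem ren_eq_etaExp {f g : ℕ → ℕ} {M V : Tm true} (h : ren f g M = etaExp V)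
    (hf : f.Injective) (hg : g.Injective) : ∃ U, M = etaExp U ∧ V = ren f g U := by
  cases M with
  | var => simp [ren, etaExp] at h
  | lam P =>
    cases P with
    | ret => simp [ren, etaExp] at h
    | bind A B C =>
      simp only [ren, etaExp, lam.injEq, bind.injEq] at h
      obtain ⟨hA, hB, hC⟩ := h
      obtain ⟨U, rfl, rfl⟩ := ren_pullback A V (up_succ_pullback f) (up_succ_pullback g) hA
      have hB' : B = var 0 := ren_injective (up_injective hf) (up_injective hg) (by rw [hB]; rfl)
      have hC' : C = ret 0 (var 0) :=
        ren_injective (up_injective (up_injective hf)) (up_injective hg) (by rw [hC]; rfl)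
      subst hB' hC'
      exact ⟨U, rfl, rfl⟩

/-- Needed because the body of an eta-expansion contains a weakened value: its reducts must again be
weakenings for the eta-redex to survive. -/
theorem Par.of_ren {b : Bool} {M N : Tm b} {f g : ℕ → ℕ} (hf : f.Injective) (hg : g.Injective)
    (h : Par (Tm.ren f g M) N) : ∃ N', N = Tm.ren f g N' ∧ Par M N' := by
  generalize hM : Tm.ren f g M = M' at h
  induction h generalizing f g with
  | var x => exact ⟨M, hM.symm, .refl _⟩
  | lam _ ih =>
    cases M with
    | var => simp [Tm.ren] at hM
    | lam P =>
      obtain ⟨N', rfl, h'⟩ := ih (up_injective hf) (up_injective hg) (by simpa [Tm.ren] using hM)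
      exact ⟨_, rfl, .lam h'⟩
  | ret k _ ih =>
    cases M with
    | bind => simp [Tm.ren] at hM
    | ret j P =>
      simp only [Tm.ren, ret.injEq] at hM
      obtain ⟨N', rfl, h'⟩ := ih hf hg hM.2
      exact ⟨Tm.ret j N', by rw [← hM.1]; rfl, .ret _ h'⟩
  | bind _ _ _ h1 h2 h3 =>
    cases M with
    | ret => simp [Tm.ren] at hM
    | bind A B C =>
      simp only [Tm.ren, bind.injEq] at hM
      obtain ⟨N1, rfl, h1'⟩ := h1 hf hg hM.1
      obtain ⟨N2, rfl, h2'⟩ := h2 hf hg hM.2.1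
      obtain ⟨N3, rfl, h3'⟩ := h3 (up_injective hf) hg hM.2.2
      exact ⟨_, rfl, .bind h1' h2' h3'⟩
  | beta _ _ _ h1 h2 h3 =>
    cases M with
    | ret => simp [Tm.ren] at hM
    | bind A B C =>
      simp only [Tm.ren, bind.injEq] at hM
      cases A with
      | var => simp [Tm.ren] at hM
      | lam A =>
        obtain ⟨N1, rfl, h1'⟩ := h1 (up_injective hf) (up_injective hg)
          (by simpa [Tm.ren] using hM.1)
        obtain ⟨N2, rfl, h2'⟩ := h2 hf hg hM.2.1
        obtain ⟨N3, rfl, h3'⟩ := h3 (up_injective hf) hg hM.2.2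
        exact ⟨_, (ren_binst _ _ _ _ _).symm, .beta h1' h2' h3'⟩
  | eta _ ih =>
    obtain ⟨U, rfl, rfl⟩ := ren_eq_etaExp hM hf hg
    obtain ⟨N', rfl, h'⟩ := ih hf hg rfl
    exact ⟨N', rfl, .eta h'⟩

/-- Critical pair: contracting the beta-redex inside the eta-expansion of `lam Q` gives back `lam
Q`, as eta does. -/
theorem binst_eta (Q : Tm false) :
    binst (ren (up Nat.succ) (up Nat.succ) Q) (var 0) (ret 0 (var 0)) = Q := by
  rw [binst, bsub_ren]
  conv_rhs => rw [← bsub_id Q]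
  congr 1 <;> funext n <;> cases n <;> rfl

/-- The other critical pair: applying an eta-expansion and contracting agrees with removing the
expansion. -/
theorem binst_bind_ren (U V : Tm true) (P : Tm false) :
    binst (bind (ren Nat.succ Nat.succ U) (var 0) (ret 0 (var 0))) V P = bind U V P := by
  have h1 : bsub (scons V ∘ Nat.succ) (kcons P ∘ Nat.succ) U = U := bsub_id U
  simp only [binst, bsub, bsub_ren, h1, scons, upV, upK, kcons, vsub_ren]
  congr 1
  conv_rhs => rw [← vsub_id P]
  congr 1; funext n; cases n <;> rfl

/-- The number of constructors. -/
def size : {b : Bool} → Tm b → ℕ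
  | _, var _ => 1
  | _, lam P => size P + 1
  | _, ret _ V => size V + 1
  | _, bind V W P => size V + size W + size P + 1

theorem size_ren {b : Bool} (f g : ℕ → ℕ) (M : Tm b) : size (ren f g M) = size M := by
  induction M generalizing f g <;> simp_all [size, ren]

/-- A parallel reduct of the body of an eta-expansion comes from a parallel reduct of the value. -/
theorem Par.of_etaExp_body {V : Tm true} {P : Tm false}
    (h : Par (Tm.bind (Tm.ren Nat.succ Nat.succ V) (Tm.var 0) (Tm.ret 0 (Tm.var 0))) P) :
    ∃ U, Par V U ∧ (P = Tm.bind (Tm.ren Nat.succ Nat.succ U) (Tm.var 0) (Tm.ret 0 (Tm.var 0)) ∨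
      (U = Tm.lam P ∧ ∃ R, V = Tm.lam R ∧ Par R P)) := by
  generalize hA : Tm.ren Nat.succ Nat.succ V = A at h
  cases h with
  | bind h1 h2 h3 =>
    subst hA
    obtain ⟨U, rfl, hU⟩ := h1.of_ren Nat.succ_injective Nat.succ_injective
    cases h2; cases h3 with
    | ret _ h4 => cases h4; exact ⟨U, hU, .inl rfl⟩
  | beta h1 h2 h3 =>
    cases V with
    | var => simp [Tm.ren] at hA
    | lam Q =>
      simp only [Tm.ren, lam.injEq] at hA
      subst hA
      obtain ⟨Q', rfl, hQ⟩ :=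
        h1.of_ren (up_injective Nat.succ_injective) (up_injective Nat.succ_injective)
      cases h2; cases h3 with
      | ret _ h4 => cases h4; exact ⟨_, .lam hQ, .inr ⟨by rw [binst_eta], Q, rfl, by rwa [binst_eta]⟩⟩

/-- The induction is on size, not on derivations: the overlaps of beta and eta call for terms that
are smaller than `M` without being subterms of it. -/
theorem Par.diamond {b : Bool} {M N1 N2 : Tm b} (h1 : Par M N1) (h2 : Par M N2) :
    ∃ N, Par N1 N ∧ Par N2 N := by
  induction hn : M.size using Nat.strong_induction_on generalizing b M N1 N2 with
  | _ n ih =>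
  subst hn
  -- Overlap of an eta-contraction with a reduction inside the expanded body.
  have lamEta : ∀ {V W : Tm true} {P : Tm false}, (etaExp V).size = M.size →
      Par (Tm.bind (Tm.ren Nat.succ Nat.succ V) (Tm.var 0) (Tm.ret 0 (Tm.var 0))) P → Par V W →
      ∃ N, Par (Tm.lam P) N ∧ Par W N := by
    intro V W P hs hP hW
    obtain ⟨U, hU, hUP⟩ := hP.of_etaExp_body
    obtain ⟨N, hN1, hN2⟩ := ih V.size
      (by rw [← hs]; simp only [etaExp, size, size_ren]; omega) hU hW rfl
    rcases hUP with rfl | ⟨rfl, -⟩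
    · exact ⟨N, .eta hN1, hN2⟩
    · exact ⟨N, hN1, hN2⟩
  -- Overlap of a beta-contraction with reductions of the three components, where the abstraction
  -- itself may be eta-contracted.
  have bindBeta : ∀ {Q Q' : Tm false} {V V1 V2 W : Tm true} {P P1 P2 : Tm false},
      (Tm.bind (Tm.lam Q) V P).size = M.size →
      Par Q Q' → Par V V1 → Par P P1 → Par (Tm.lam Q) W → Par V V2 → Par P P2 →
      ∃ N, Par (Tm.binst Q' V1 P1) N ∧ Par (Tm.bind W V2 P2) N := by
    intro Q Q' V V1 V2 W P P1 P2 hs hQ hV1 hP1 hW hV2 hP2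
    simp only [size] at hs
    obtain ⟨V3, hV13, hV23⟩ := ih V.size (by omega) hV1 hV2 rfl
    obtain ⟨P3, hP13, hP23⟩ := ih P.size (by omega) hP1 hP2 rfl
    generalize hL : Tm.lam Q = L at hW
    cases hW with
    | var => cases hL
    | lam hQ2 =>
      cases hL
      obtain ⟨Q3, hQ13, hQ23⟩ := ih Q.size (by omega) hQ hQ2 rfl
      exact ⟨_, hQ13.binst hV13 hP13, .beta hQ23 hV23 hP23⟩
    | @eta U _ hU =>
      simp only [etaExp, lam.injEq] at hL
      subst hL
      simp only [size, size_ren] at hs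
      obtain ⟨U1, hU1, hUP⟩ := hQ.of_etaExp_body
      rcases hUP with rfl | ⟨-, R, rfl, hR⟩
      · obtain ⟨U3, hU13, hU23⟩ := ih U.size (by omega) hU1 hU rfl
        rw [binst_bind_ren]
        exact ⟨_, .bind hU13 hV13 hP13, .bind hU23 hV23 hP23⟩
      -- Here the abstraction is the eta-expansion of `lam R` and its inner beta-redex was
      -- contracted. Both results are reducts of the smaller command with `lam R` in its place.
      · exact ih (Tm.bind (Tm.lam R) V P).size (by simp only [size] at hs ⊢; omega)
          (.beta hR hV1 hP1) (.bind hU hV2 hP2) rfl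
  cases h1 with
  | var => exact ⟨_, h2, .refl _⟩
  | lam h1 =>
    rename_i P P1
    generalize hL : Tm.lam P = L at h2
    cases h2 with
    | var => cases hL
    | lam h2 =>
      cases hL
      obtain ⟨P3, h13, h23⟩ := ih P.size (by simp [size]) h1 h2 rfl
      exact ⟨_, .lam h13, .lam h23⟩
    | eta h2 =>
      simp only [etaExp, lam.injEq] at hL
      subst hL
      exact lamEta rfl h1 h2
  | ret k h1 =>
    cases h2 with
    | ret _ h2 =>
      obtain ⟨P3, h13, h23⟩ := ih _ (by simp [size]) h1 h2 rfl
      exact ⟨_, .ret k h13, .ret k h23⟩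
  | bind hV hW hP =>
    rename_i V _ W _ P _
    cases h2 with
    | bind hV' hW' hP' =>
      obtain ⟨V3, a1, a2⟩ := ih V.size (by simp only [size]; omega) hV hV' rfl
      obtain ⟨W3, b1, b2⟩ := ih W.size (by simp only [size]; omega) hW hW' rfl
      obtain ⟨P3, c1, c2⟩ := ih P.size (by simp only [size]; omega) hP hP' rfl
      exact ⟨_, .bind a1 b1 c1, .bind a2 b2 c2⟩
    | beta hV' hW' hP' =>
      obtain ⟨N, a1, a2⟩ := bindBeta rfl hV' hW' hP' hV hW hP
      exact ⟨N, a2, a1⟩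
  | beta hV hW hP =>
    rename_i V _ W _ P _
    cases h2 with
    | bind hV' hW' hP' => exact bindBeta rfl hV hW hP hV' hW' hP'
    | beta hV' hW' hP' =>
      obtain ⟨V3, a1, a2⟩ := ih V.size (by simp only [size]; omega) hV hV' rfl
      obtain ⟨W3, b1, b2⟩ := ih W.size (by simp only [size]; omega) hW hW' rfl
      obtain ⟨P3, c1, c2⟩ := ih P.size (by simp only [size]; omega) hP hP' rfl
      exact ⟨_, a1.binst b1 c1, a2.binst b2 c2⟩
  | @eta V _ h1 =>
    have h2' : Par (etaExp V) N2 := h2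
    generalize hL : etaExp V = L at h2'
    cases h2' with
    | var => cases hL
    | lam h2 =>
      cases hL
      obtain ⟨N, a1, a2⟩ := lamEta rfl h2 h1
      exact ⟨N, a2, a1⟩
    | eta h2 =>
      simp only [etaExp, lam.injEq, bind.injEq] at hL
      have := ren_injective Nat.succ_injective Nat.succ_injective hL.1
      subst this
      exact ih V.size (by simp only [etaExp, size, size_ren]; omega) h1 h2 rfl

/-! ### Single steps and convertibility in the target calculus. -/

/-- One-step reduction. -/
inductive Step : {b : Bool} → Tm b → Tm b → Prop
  | lam {P P' : Tm false} : Step P P' → Step (lam P) (lam P')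
  | ret (k : ℕ) {V V' : Tm true} : Step V V' → Step (ret k V) (ret k V')
  | bindFun {V V' : Tm true} (W : Tm true) (P : Tm false) : Step V V' →
      Step (bind V W P) (bind V' W P)
  | bindArg (V : Tm true) {W W' : Tm true} (P : Tm false) : Step W W' →
      Step (bind V W P) (bind V W' P)
  | bindBody (V W : Tm true) {P P' : Tm false} : Step P P' → Step (bind V W P) (bind V W P')
  | beta (Q : Tm false) (V : Tm true) (P : Tm false) : Step (bind (Tm.lam Q) V P) (binst Q V P)
  | eta (V : Tm true) : Step (etaExp V) V

open Relation in
-- The inverse translation is checked on single steps only, so parallel reductions have to be split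
-- up.
theorem Par.steps {b : Bool} {M N : Tm b} (h : Par M N) : ReflTransGen Step M N := by
  have hbind : ∀ {V V' W W' : Tm true} {P P' : Tm false}, ReflTransGen Step V V' →
      ReflTransGen Step W W' → ReflTransGen Step P P' →
      ReflTransGen Step (Tm.bind V W P) (Tm.bind V' W' P') := fun h1 h2 h3 =>
    ((h1.lift (fun V => Tm.bind V _ _) fun _ _ => .bindFun _ _).trans
      (h2.lift (fun W => Tm.bind _ W _) fun _ _ => .bindArg _ _)).trans
      (h3.lift (fun P => Tm.bind _ _ P) fun _ _ => .bindBody _ _)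
  induction h with
  | var => exact .refl
  | lam _ ih => exact ih.lift _ fun _ _ => .lam
  | ret k _ ih => exact ih.lift _ fun _ _ => .ret k
  | bind _ _ _ h1 h2 h3 => exact hbind h1 h2 h3
  | beta _ _ _ h1 h2 h3 =>
    exact (hbind (h1.lift _ fun _ _ => .lam) h2 h3).tail (.beta _ _ _)
  | eta _ ih => exact .head (.eta _) ih

open Relation in
/-- Convertibility, in the form of joinability under parallel reduction. -/
def Cv {b : Bool} (M N : Tm b) : Prop := Join (ReflTransGen Par) M N

open Relation in
theorem cv_equivalence {b : Bool} : Equivalence (Cv (b := b)) :=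
  equivalence_join_reflTransGen fun _ _ _ h1 h2 =>
    let ⟨N, a, c⟩ := Par.diamond h1 h2
    ⟨N, .single a, .single c⟩

theorem Cv.refl {b : Bool} (M : Tm b) : Cv M M := cv_equivalence.refl M
theorem Cv.symm {b : Bool} {M N : Tm b} (h : Cv M N) : Cv N M := cv_equivalence.symm h
theorem Cv.trans {b : Bool} {M N P : Tm b} (h : Cv M N) (h' : Cv N P) : Cv M P :=
  cv_equivalence.trans h h'

theorem Cv.of_par {b : Bool} {M N : Tm b} (h : Par M N) : Cv M N := ⟨N, .single h, .refl⟩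

theorem Cv.map {b c : Bool} (F : Tm b → Tm c) (hF : ∀ {M N}, Par M N → Par (F M) (F N))
    {M N : Tm b} (h : Cv M N) : Cv (F M) (F N) := by
  obtain ⟨P, h1, h2⟩ := h
  exact ⟨F P, h1.lift F fun _ _ => hF, h2.lift F fun _ _ => hF⟩


/-! ### The continuation-passing translation. -/

/-- The continuation substitution that replaces index `0` by `P`, where the continuation variable
`0` of `P` takes the place of the replaced one. -/
def kset (P : Tm false) : ℕ → Tm false
  | 0 => P
  | k + 1 => ret (k + 1) (var 0)

/-- The renaming that replaces index `0` by `k + 1`. -/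
def thr (k : ℕ) : ℕ → ℕ
  | 0 => k + 1
  | n + 1 => n + 1

/-- The continuation-passing translation; index `0` is the current continuation. -/
def cps : CTTerm → Tm false
  | .var x => ret 0 (var x)
  | .lam M => ret 0 (ren id Nat.succ (lam (cps M)))
  | .app M N => bsub var (kset (bsub var (kset (bind (var 1) (var 0) (ret 0 (var 0))))
      (ren Nat.succ id (cps N)))) (cps M)
  | .letIn L M => bsub var (kset (cps L)) (cps M)
  -- `Nat.pred` sends both `0` and `1` to `0`: the variable bound by `ε` is identified with the
  -- current continuation.
  | .eps M => ren id Nat.pred (cps M)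
  | .throw k M => ren id (thr k) (cps M)

theorem bsub_congr {b : Bool} {s s' : ℕ → Tm true} {t t' : ℕ → Tm false} (hs : ∀ n, s n = s' n)
    (ht : ∀ k, t k = t' k) (M : Tm b) : bsub s t M = bsub s' t' M := by
  rw [funext hs, funext ht]

theorem ren_congr {b : Bool} {f f' g g' : ℕ → ℕ} (hf : ∀ n, f n = f' n) (hg : ∀ n, g n = g' n)
    (M : Tm b) : ren f g M = ren f' g' M := by
  rw [funext hf, funext hg]

theorem ren_eq_bsub {b : Bool} (f g : ℕ → ℕ) (M : Tm b) :
    ren f g M = bsub (fun n => var (f n)) (kvar g) M := by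
  rw [bsub_kvar, vsub_var]

/-- The source continuation variable `k` has index `k + 1` in the target, index `0` being the
current continuation; hence `up g`. -/
theorem cps_rename (f g : ℕ → ℕ) (M : CTTerm) : cps (M.rename f g) = ren f (up g) (cps M) := by
  induction M generalizing f g with
  | var x => rfl
  | lam M ih =>
    simp only [cps, CTTerm.rename, ih, ren, ren_ren, up_id]
    refine congrArg (fun P => ret 0 (lam P)) (ren_congr (fun n => rfl) (fun k => ?_) _)
    cases k <;> rfl
  | app M N ih1 ih2 =>
    simp only [cps, CTTerm.rename, ih1, ih2, ren_ren, ren_bsub, bsub_ren]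
    refine bsub_congr (fun n => rfl) (fun k => ?_) _
    cases k
    · simp only [kset, Function.comp, up, ren_bsub]
      refine bsub_congr (fun n => rfl) (fun k => ?_) _
      cases k <;> rfl
    · rfl
  | letIn L M ih1 ih2 =>
    simp only [cps, CTTerm.rename, ih1, ih2, ren_bsub, bsub_ren]
    refine bsub_congr (fun n => rfl) (fun k => ?_) _
    cases k <;> rfl
  | eps M ih =>
    simp only [cps, CTTerm.rename, ih, ren_ren]
    refine ren_congr (fun n => rfl) (fun k => ?_) _
    rcases k with _ | _ | k <;> rfl
  | throw k M ih =>
    simp only [cps, CTTerm.rename, ih, ren_ren]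
    refine ren_congr (fun n => rfl) (fun k => ?_) _
    cases k <;> rfl

/-- The hypothesis says that each `s n` behaves as a value with translation `v n`, weakened because
it does not mention the current continuation. -/
theorem cps_subst (s : ℕ → CTTerm) (v : ℕ → Tm true) (M : CTTerm)
    (hs : ∀ n, cps (s n) = ret 0 (ren id Nat.succ (v n))) :
    cps (M.subst s) = vsub (fun n => ren id Nat.succ (v n)) id (cps M) := by
  have hup : ∀ {s : ℕ → CTTerm} {v : ℕ → Tm true},
      (∀ n, cps (s n) = ret 0 (ren id Nat.succ (v n))) →
      ∀ n, cps (CTTerm.upSubst s n) = ret 0 (ren id Nat.succ (upV v n)) := by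
    intro s v hs n
    cases n with
    | zero => rfl
    | succ n => simp only [CTTerm.upSubst, CTTerm.shift, cps_rename, hs, ren, upV, ren_ren]; rfl
  have hupV : ∀ v : ℕ → Tm true, (fun n => ren id Nat.succ (upV v n)) =
      upV fun n => ren id Nat.succ (v n) := by
    intro v; funext n
    cases n with
    | zero => rfl
    | succ n => simp only [upV, ren_ren]; rfl
  induction M generalizing s v with
  | var x => simp only [CTTerm.subst, hs, cps, vsub, id]
  | lam M ih =>
    simp only [CTTerm.subst, cps, ih _ _ (hup hs), ren, vsub, ren_vsub, vsub_ren, up_id]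
    congr 3; funext n; cases n
    · rfl
    · simp only [upV, Function.comp, upL, ren_ren, id]; rfl
  | app M N ih1 ih2 =>
    simp only [CTTerm.subst, cps, ih1 _ _ hs, ih2 _ _ hs, vsub_bsub, bsub_vsub]
    refine bsub_congr (fun n => ?_) (fun k => ?_) _
    · simp only [bsub_ren]
      exact (bsub_kvar _ _ _).trans (vsub_var _ _ _)
    · cases k
      · simp only [kset, Function.comp, id, vsub_bsub, bsub_ren, ren_vsub, bsub_vsub]
        refine bsub_congr (fun n => ?_) (fun k => ?_) _
        · exact (bsub_kvar _ _ _).trans ((vsub_var Nat.succ Nat.succ _).trans (ren_ren Nat.succ id id Nat.succ _).symm)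
        · cases k <;> rfl
      · rfl
  | letIn L M ih1 ih2 =>
    simp only [CTTerm.subst, cps, ih1 _ _ (hup hs), ih2 _ _ hs, vsub_bsub, bsub_vsub]
    refine bsub_congr (fun n => ?_) (fun k => ?_) _
    · simp only [bsub_ren]
      exact (bsub_kvar _ _ _).trans (vsub_var _ _ _)
    · cases k
      · simp only [kset, Function.comp, id, hupV]
      · rfl
  | eps M ih =>
    have hs' : ∀ n, cps (s n).cshift = ret 0 (ren id Nat.succ (ren id Nat.succ (v n))) := by
      intro n
      simp only [CTTerm.cshift, cps_rename, hs, ren, ren_ren]; rfl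
    simp only [CTTerm.subst, cps, ih _ _ hs', ren_vsub, vsub_ren, ren_ren]
    rfl
  | throw k M ih =>
    simp only [CTTerm.subst, cps, ih _ _ hs, ren_vsub, vsub_ren, ren_ren]
    rfl

/-- Evaluates a composite substitution at a continuation that the first substitution leaves as a
variable. -/
theorem bsub_upV_ret (s : ℕ → Tm true) (t : ℕ → Tm false) (j : ℕ) :
    bsub (upV s) (upK t) (ret j (var 0)) = t j := by
  simp only [bsub, upV, upK, vsub_ren]
  conv_rhs => rw [← vsub_id (t j)]
  congr 1; funext n; cases n <;> rfl

/-- The continuation substitution that replaces `k + 1` by `P`. -/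
def kat (k : ℕ) (P : Tm false) (j : ℕ) : Tm false := if j = k + 1 then P else ret j (var 0)

theorem kat_self (k : ℕ) (P : Tm false) : kat k P (k + 1) = P := if_pos rfl

theorem kat_ne {j k : ℕ} {P : Tm false} (h : j ≠ k + 1) : kat k P j = ret j (var 0) := if_neg h

theorem upK_kat (k : ℕ) (P : Tm false) : upK (kat k P) = kat k (ren (up Nat.succ) id P) := by
  funext j; simp only [upK, kat]; split <;> rfl

/-- Shared by the application and let cases below. The inserted continuation has been renamed by
`thr k`, whose image avoids `0`, so replacing the current continuation does not affect it. -/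
theorem bsub_kset_kat (k : ℕ) (P A A' M : Tm false)
    (h : A' = bsub var (upK (kat k (ren id (thr k) P))) A) :
    bsub var (kset A') (bsub var (kat k (ren id (thr k) P)) M) =
      bsub var (kat k (ren id (thr k) P)) (bsub var (kset A) M) := by
  rw [bsub_bsub, bsub_bsub]
  refine bsub_congr (fun n => rfl) (fun j => ?_) _
  rcases j with _ | j
  · rw [kat, if_neg (by omega), bsub_upV_ret, upV_id]
    exact h
  · simp only [kset]
    rw [bsub_upV_ret, kat]
    split
    · rw [upV_id, bsub_ren, ren_eq_bsub]
      refine bsub_congr (fun n => rfl) (fun j => ?_) _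
      cases j <;> rfl
    · rw [bsub_upV_ret]; rfl

/-- Structural substitution is ordinary substitution for the continuation variable `k + 1`. The new
continuation is `L`, whose own result goes to `k` by `thr k`. -/
theorem cps_structSubst (k : ℕ) (L N : CTTerm) :
    cps (CTTerm.structSubst k L N) = bsub var (kat k (ren id (thr k) (cps L))) (cps N) := by
  have hshift : ∀ k (L : CTTerm), kat k (ren id (thr k) (cps L.shiftUnder)) =
      upK (kat k (ren id (thr k) (cps L))) := by
    intro k L
    rw [upK_kat, CTTerm.shiftUnder, cps_rename, ren_ren, ren_ren, up_id]
    rfl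
  induction N generalizing k L with
  | var x => simp [CTTerm.structSubst, cps, bsub, vsub, scons, kat]
  | lam M ih =>
    simp only [CTTerm.structSubst, cps, ih, ren, bsub, hshift, bsub_ren,
      ren_bsub, upL_id]
    refine congrArg (fun P => ret 0 (lam P)) (bsub_congr (fun n => ?_) (fun j => ?_) _)
    · cases n <;> rfl
    · rcases j with _ | j
      · rfl
      · simp only [Function.comp, up, upKL, Nat.succ_eq_add_one, upK, kat,
          Nat.add_right_cancel_iff]
        split
        · simp only [ren_ren]
          refine ren_congr (fun n => ?_) (fun j => ?_) _
          · rcases n with _ | _ | n <;> rfl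
          · cases j <;> rfl
        · rfl
  | app M N ih1 ih2 =>
    simp only [CTTerm.structSubst, cps, ih1, ih2]
    refine bsub_kset_kat _ _ _ _ _ ?_
    have h : ren Nat.succ id (bsub var (kat k (ren id (thr k) (cps L))) (cps N)) =
        bsub var (kat k (ren id (thr k) (cps L.shiftUnder))) (ren Nat.succ id (cps N)) := by
      rw [hshift, ren_bsub, bsub_ren]; rfl
    rw [h, ← hshift]
    exact bsub_kset_kat _ _ _ _ _ rfl
  | letIn L M ih1 ih2 =>
    simp only [CTTerm.structSubst, cps, ih1, ih2, hshift]
    exact bsub_kset_kat _ _ _ _ _ rfl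
  | eps M ih =>
    simp only [CTTerm.structSubst, CTTerm.cshift, cps_rename, cps, ih, ren_bsub, bsub_ren]
    refine bsub_congr (fun n => rfl) (fun j => ?_) _
    rcases j with _ | _ | j
    · rfl
    · rfl
    · simp only [Function.comp, kat, Nat.pred_succ, Nat.add_right_cancel_iff]
      split
      · simp only [ren_ren]
        refine ren_congr (fun n => ?_) (fun j => ?_) _
        · cases n <;> rfl
        · cases j <;> rfl
      · rfl
  | throw j M ih =>
    simp only [CTTerm.structSubst]
    split
    · next h =>
      subst h
      simp only [cps, ih]
      rw [bsub_bsub, ren_bsub, bsub_ren]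
      refine bsub_congr (fun n => rfl) (fun i => ?_) _
      rcases i with _ | i
      · change ren (up id) _ (bsub (upV var) (upK _) (ret 0 (var 0))) = kat _ _ (_ + 1)
        rw [bsub_upV_ret, kat_self, up_id]
        rfl
      · change ren (up id) _ (bsub (upV var) (upK _) (kat _ _ (i + 1))) = kat _ _ (i + 1)
        by_cases hi : i = j
        · subst hi
          rw [kat_self, upV_id, bsub_ren, ren_bsub, ren_eq_bsub, up_id]
          refine bsub_congr (fun n => rfl) (fun j => ?_) _
          cases j <;> rfl
        · rw [kat_ne (by omega), bsub_upV_ret]; rfl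
    · next h =>
      simp only [cps, ih]
      rw [ren_bsub, bsub_ren]
      refine bsub_congr (fun n => rfl) (fun i => ?_) _
      rcases i with _ | i
      · change ren _ _ (kat _ _ 0) = kat _ _ (j + 1)
        rw [kat_ne (j := 0) (by omega), kat_ne (by omega)]
        rfl
      · change ren _ _ (kat _ _ (i + 1)) = kat _ _ (i + 1)
        by_cases hi : i = k
        · subst hi
          rw [kat_self]
          simp only [ren_ren]
          refine ren_congr (fun n => ?_) (fun j => ?_) _
          · cases n <;> rfl
          · cases j <;> rfl
        · rw [kat_ne (by omega)]
          rfl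

/-- The translation of a value. -/
def cval : CTTerm → Tm true
  | .lam M => lam (cps M)
  | .var x => var x
  -- A dummy result: `cval` is only applied to values.
  | _ => var 0

theorem cps_value {V : CTTerm} (h : V.IsValue) : cps V = ret 0 (ren id Nat.succ (cval V)) := by
  cases h <;> rfl

theorem cps_inst {V : CTTerm} (h : V.IsValue) (M : CTTerm) :
    cps (CTTerm.inst V M) = vsub (scons (ren id Nat.succ (cval V))) id (cps M) := by
  rw [CTTerm.inst, cps_subst _ (scons (cval V))]
  · congr 1; funext n; cases n <;> rfl
  · intro n
    cases n with
    | zero => exact cps_value h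
    | succ n => rfl

/-- Binding a value passes it directly to `A`, which is why `betaLet` becomes an identity. -/
theorem bsub_kset_value (A : Tm false) {V : CTTerm} (h : V.IsValue) :
    bsub var (kset A) (cps V) = vsub (scons (ren id Nat.succ (cval V))) id A := by
  rw [cps_value h]
  simp only [bsub, bsub_ren]
  congr 2
  rw [ren_eq_bsub]; rfl

theorem cval_rename (f g : ℕ → ℕ) {V : CTTerm} (h : V.IsValue) :
    cval (V.rename f g) = ren f g (cval V) := by
  cases h with
  | var => rfl
  | lam M => simp [cval, CTTerm.rename, ren, cps_rename]

theorem isValue_rename (f g : ℕ → ℕ) {V : CTTerm} (h : V.IsValue) : (V.rename f g).IsValue := by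
  cases h <;> constructor

theorem cps_app_value {V W : CTTerm} (hV : V.IsValue) (hW : W.IsValue) :
    cps (.app V W) = bind (ren id Nat.succ (cval V)) (ren id Nat.succ (cval W)) (ret 0 (var 0)) := by
  rw [cps, bsub_kset_value _ hV]
  have h := cps_rename Nat.succ id W
  rw [up_id] at h
  rw [← h, bsub_kset_value _ (isValue_rename _ _ hW), cval_rename _ _ hW]
  have h' : ren id Nat.succ (ren Nat.succ id (cval W)) = ren Nat.succ id (ren id Nat.succ (cval W)) := by
    rw [ren_ren, ren_ren]; rfl
  rw [h']
  change bind (ren id Nat.succ (cval V))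
    (vsub (scons _) id (ren Nat.succ id (ren id Nat.succ (cval W)))) (ret 0 (var 0)) = _
  rw [scons_ren_zero, ren_id]

/-! ### Soundness of the translation for equality and reduction. -/

/-- The first axiom is associativity of substitution. The other two hold because renaming the
current continuation distributes over the substitution that interprets `let`. -/
theorem cps_eqAxiom {M N : CTTerm} (h : CTTerm.EqAxiom M N) : cps M = cps N := by
  cases h with
  | assoc L M N =>
    simp only [cps, bsub_bsub, CTTerm.shiftUnder, cps_rename]
    refine bsub_congr (fun n => rfl) (fun j => ?_) _
    cases j
    · simp only [kset]
      rw [upV_id]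
      refine bsub_congr (fun n => rfl) (fun j => ?_) _
      cases j
      · exact congrArg (fun g => ren (up Nat.succ) g (cps L)) up_id.symm
      · rfl
    · simp only [kset]; rw [bsub_upV_ret]; rfl
  | epsLet M N =>
    simp only [cps, CTTerm.cshift, cps_rename]
    rw [bsub_ren, ren_bsub]
    refine bsub_congr (fun n => rfl) (fun j => ?_) _
    rcases j with _ | j
    · rw [up_id]; rfl
    · rfl
  | throwLet k M N =>
    simp only [cps, ren_bsub]
    refine bsub_congr (fun n => rfl) (fun j => ?_) _
    cases j
    · rw [kset, kset, up_id]
    · rfl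

theorem kset_ret_zero : kset (ret 0 (var 0)) = kvar id := by
  funext k; cases k <;> rfl

theorem upK_kset (A : Tm false) : upK (kset A) = kset (ren (up Nat.succ) id A) := by
  funext k; cases k <;> rfl

/-- A command that ignores its current continuation is unaffected by replacing it. -/
theorem bsub_kset_thr (A M : Tm false) (k : ℕ) :
    bsub var (kset A) (ren id (thr k) M) = ren id (thr k) M := by
  rw [bsub_ren, ren_eq_bsub]
  refine bsub_congr (fun n => rfl) (fun j => ?_) _
  cases j <;> rfl

theorem cps_app_nonvalue (N M : CTTerm) :
    cps (.app N M) = cps (.letIn (.app (.var 0) (CTTerm.shift M)) N) := by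
  simp only [cps, CTTerm.shift, cps_rename, up_id]
  refine bsub_congr (fun n => rfl) (fun j => ?_) _
  cases j
  · simp only [kset, bsub, vsub_bsub, bsub_ren]
    refine bsub_congr (fun n => rfl) (fun k => ?_) _
    cases k <;> rfl
  · rfl

theorem cps_app_value_nonvalue {V : CTTerm} (hV : V.IsValue) (N : CTTerm) :
    cps (.app V N) = cps (.letIn (.app (CTTerm.shift V) (.var 0)) N) := by
  rw [CTTerm.shift, cps, bsub_kset_value _ hV, cps,
    cps_app_value (isValue_rename Nat.succ id hV) (.var 0), vsub_bsub, bsub_ren,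
    cval_rename _ _ hV]
  refine bsub_congr (fun n => rfl) (fun j => ?_) _
  cases j
  · change bind (ren Nat.succ id (ren id Nat.succ (cval V))) (var 0) (ret 0 (var 0)) =
      bind (ren id Nat.succ (ren Nat.succ id (cval V))) (var 0) (ret 0 (var 0))
    rw [ren_ren, ren_ren]
    rfl
  · rfl

/-- Only `betaLam` and `etaLam` take a genuine step; in all other cases the two translations
coincide. -/
theorem cps_rule {M N : CTTerm} (h : CTTerm.Rule M N) : Par (cps M) (cps N) := by
  cases h with
  | ad₁ N M h =>
    rw [cps_app_nonvalue]; exact .refl _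
  | ad₂ V N hV h =>
    rw [cps_app_value_nonvalue hV]; exact .refl _
  | betaLam M V hV =>
    rw [cps_app_value (.lam M) hV, cps, bsub_kset_value _ hV]
    have h := Par.beta (.refl (ren (up id) (up Nat.succ) (cps M)))
      (.refl (ren id Nat.succ (cval V))) (.refl (ret 0 (var 0)))
    rw [binst, bsub_ren] at h
    rw [← bsub_kvar]
    refine cast ?_ h
    congr 1
    refine bsub_congr (fun n => ?_) (fun j => ?_) _
    · cases n <;> rfl
    · cases j <;> rfl
  | betaLet M V hV =>
    rw [cps_inst hV, cps, bsub_kset_value _ hV]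
    exact .refl _
  | etaLam V h =>
    rw [CTTerm.shift, cps_value h, cps, cps_app_value (isValue_rename _ _ h) (.var 0), cval_rename _ _ h]
    refine .ret _ (.ren (M := lam _) ?_ _ _)
    rw [ren_ren]
    exact .eta (.refl _)
  | etaLet =>
    rw [cps, cps, kset_ret_zero, bsub_id]
    exact .refl _
  | epsDummy =>
    rw [cps, CTTerm.cshift, cps_rename, ren_ren]
    refine cast ?_ (Par.refl (cps N))
    congr 1
    conv_lhs => rw [← ren_id (cps N)]
    refine ren_congr (fun n => rfl) (fun k => ?_) _
    cases k <;> rfl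
  | epsThrow M =>
    rw [cps, cps, cps, ren_ren]
    refine cast ?_ (Par.refl (ren id Nat.pred (cps M)))
    congr 1
    refine ren_congr (fun n => rfl) (fun k => ?_) _
    cases k <;> rfl
  | letThrow M k N =>
    rw [cps, cps, bsub_kset_thr]
    exact .refl _
  | throwThrow l k N =>
    rw [cps, cps, ren_ren]
    refine cast ?_ (Par.refl (ren id (thr k) (cps N)))
    congr 1
    refine ren_congr (fun n => rfl) (fun k => ?_) _
    cases k <;> rfl
  | letEps M N =>
    have h0 : cps (.letIn M (.eps N)) = cps (.eps (.letIn (CTTerm.cshift M)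
        (CTTerm.structSubst 0 (CTTerm.cshift M) N))) := by
      have hpred : ∀ g : ℕ → ℕ, (∀ k, k = g k) → cps M = ren id g (cps M) := fun g hg => by
        conv_lhs => rw [← ren_id (cps M)]
        exact ren_congr (fun n => rfl) hg _
      simp only [cps, cps_structSubst, CTTerm.cshift, cps_rename]
      rw [bsub_ren, bsub_bsub, ren_bsub]
      refine bsub_congr (fun n => rfl) (fun j => ?_) _
      -- The indices of `N` are its current continuation `0`, the bound `k` at `1`, and the rest. On
      -- both sides `0` and `1` end in the continuation `M`; a throw to `k` has passed through `M`
      -- once and is not captured again.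
      rcases j with _ | _ | j
      · rw [kat_ne (by omega), bsub_upV_ret]
        change cps M = ren (up id) Nat.pred (ren id (up Nat.succ) (cps M))
        rw [ren_ren, up_id]
        exact hpred _ fun k => by cases k <;> rfl
      · rw [kat_self, upV_id, upK_kset, bsub_kset_thr, ren_ren, ren_ren, up_id]
        exact hpred _ fun k => by cases k <;> rfl
      · rfl
    rw [h0]; exact .refl _
  | throwEps l M =>
    rw [cps, cps, CTTerm.cinst, cps, cps_rename, ren_ren, ren_ren]
    refine cast ?_ (Par.refl (ren (id ∘ id) (thr l ∘ Nat.pred) (cps M)))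
    congr 1
    refine ren_congr (fun n => rfl) (fun k => ?_) _
    rcases k with _ | _ | k <;> rfl
  | epsEps M =>
    rw [cps, cps, CTTerm.cinst, cps, cps_rename, ren_ren, ren_ren]
    refine cast ?_ (Par.refl (ren (id ∘ id) (Nat.pred ∘ Nat.pred) (cps M)))
    congr 1
    refine ren_congr (fun n => rfl) (fun k => ?_) _
    rcases k with _ | _ | k <;> rfl

theorem cv_of_conv {M N : CTTerm} (h : CTTerm.Conv M N) : Cv (cps M) (cps N) := by
  have hk : ∀ {P P' : Tm false}, Par P P' → ∀ k, Par (kset P k) (kset P' k) := by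
    intro P P' h k
    cases k with
    | zero => exact h
    | succ k => exact .refl _
  have hb : ∀ {M M' P P' : Tm false}, Cv M M' → Cv P P' →
      Cv (bsub var (kset P) M) (bsub var (kset P') M') := fun h1 h2 =>
    (h1.map (fun M => bsub var (kset _) M)
      fun h => h.bsub (fun _ => .refl _) (fun _ => .refl _)).trans
    (h2.map (fun P => bsub var (kset P) _)
      fun h => (Par.refl _).bsub (fun _ => .refl _) (hk h))
  induction h with
  | base h =>
    rcases h with h | h
    · rw [cps_eqAxiom h]; exact .refl _
    · exact .of_par (cps_rule h)
  | refl => exact .refl _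
  | symm _ ih => exact ih.symm
  | trans _ _ h1 h2 => exact h1.trans h2
  | lam _ ih =>
    exact ih.map (fun P => ret 0 (ren id Nat.succ (lam P))) fun h => .ret _ ((Par.lam h).ren _ _)
  | app _ _ h1 h2 =>
    exact hb h1 (hb (h2.map (ren Nat.succ id) fun h => h.ren _ _) (.refl _))
  | letIn _ _ h1 h2 => exact hb h2 h1
  | eps _ ih => exact ih.map (ren id Nat.pred) fun h => h.ren _ _
  | throw k _ ih => exact ih.map (ren id (thr k)) fun h => h.ren _ _

end Tm

/-! ### Renaming in the source calculus. -/

namespace CTTerm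
open Tm (up_id up_comp)

theorem rename_id (M : CTTerm) : rename id id M = M := by
  induction M <;> simp_all [rename, up_id]

theorem rename_rename (f g f' g' : ℕ → ℕ) (M : CTTerm) :
    rename f g (rename f' g' M) = rename (f ∘ f') (g ∘ g') M := by
  induction M generalizing f g f' g' <;> simp_all [rename, up_comp]

theorem rename_comm {f1 g1 f2 g2 f3 g3 f4 g4 : ℕ → ℕ} (hf : ∀ n, f1 (f2 n) = f3 (f4 n))
    (hg : ∀ n, g1 (g2 n) = g3 (g4 n)) (M : CTTerm) :
    rename f1 g1 (rename f2 g2 M) = rename f3 g3 (rename f4 g4 M) := by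
  rw [rename_rename, rename_rename, funext (f := f1 ∘ f2) hf, funext (f := g1 ∘ g2) hg]
  rfl

theorem rename_shift (f g : ℕ → ℕ) (M : CTTerm) :
    rename (up f) g (shift M) = shift (rename f g M) := by
  unfold shift
  refine rename_comm (fun n => ?_) (fun n => ?_) M <;> cases n <;> rfl

theorem rename_shiftUnder (f g : ℕ → ℕ) (M : CTTerm) :
    rename (up (up f)) g (shiftUnder M) = shiftUnder (rename (up f) g M) := by
  unfold shiftUnder
  refine rename_comm (fun n => ?_) (fun n => ?_) M <;> cases n <;> rfl

theorem rename_cshift (f g : ℕ → ℕ) (M : CTTerm) :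
    rename f (up g) (cshift M) = cshift (rename f g M) := by
  unfold cshift
  refine rename_comm (fun n => ?_) (fun n => ?_) M <;> cases n <;> rfl

theorem rename_cinst (f g : ℕ → ℕ) (l : ℕ) (M : CTTerm) :
    rename f g (cinst l M) = cinst (g l) (rename f (up g) M) := by
  unfold cinst
  refine rename_comm (fun n => ?_) (fun n => ?_) M <;> cases n <;> rfl

theorem cinst_cshift (l : ℕ) (M : CTTerm) : cinst l (cshift M) = M := by
  rw [cinst, cshift, rename_rename]
  exact rename_id M

theorem rename_upSubst {f g f' : ℕ → ℕ} {s s' : ℕ → CTTerm}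
    (h : ∀ n, rename f g (s n) = s' (f' n)) (n : ℕ) :
    rename (up f) g (upSubst s n) = upSubst s' (up f' n) := by
  cases n with
  | zero => rfl
  | succ n => simp only [upSubst, rename_shift, h, up]

theorem rename_subst {f g f' : ℕ → ℕ} {s s' : ℕ → CTTerm}
    (h : ∀ n, rename f g (s n) = s' (f' n)) (M : CTTerm) :
    rename f g (subst s M) = subst s' (rename f' g M) := by
  induction M generalizing f g f' s s' with
  | var x => exact h x
  | lam M ih => simp only [subst, rename, ih (rename_upSubst h)]
  | app M N ih1 ih2 => simp only [subst, rename, ih1 h, ih2 h]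
  | letIn L M ih1 ih2 => simp only [subst, rename, ih1 (rename_upSubst h), ih2 h]
  | eps M ih =>
    simp only [subst, rename]
    rw [ih (s' := fun n => cshift (s' n)) fun n => by rw [rename_cshift, h]]
  | throw k M ih => simp only [subst, rename, ih h]

theorem rename_inst (f g : ℕ → ℕ) (V M : CTTerm) :
    rename f g (inst V M) = inst (rename f g V) (rename (up f) g M) :=
  rename_subst (fun n => by cases n <;> rfl) M

/-- The renaming may merge other continuation variables, but nothing else may be sent to the image
of `k`. -/
theorem rename_structSubst {f g : ℕ → ℕ} {k k' : ℕ} (hk : ∀ j, g j = k' ↔ j = k)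
    (L N : CTTerm) :
    rename f g (structSubst k L N) = structSubst k' (rename (up f) g L) (rename f g N) := by
  induction N generalizing f g k k' L with
  | var x => rfl
  | lam M ih => simp only [structSubst, rename, ih hk, rename_shiftUnder]
  | app M N ih1 ih2 => simp only [structSubst, rename, ih1 hk, ih2 hk]
  | letIn M N ih1 ih2 => simp only [structSubst, rename, ih1 hk, ih2 hk, rename_shiftUnder]
  | eps M ih =>
    have hk' : ∀ j, up g j = k' + 1 ↔ j = k + 1 := fun j => by
      cases j <;> simp [up, hk]
    simp only [structSubst, rename, ih hk', rename_cshift]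
  | throw j M ih =>
    simp only [structSubst]
    by_cases h : j = k
    · simp only [if_pos h, rename, if_pos ((hk j).2 h), structSubst, ih hk, (hk k).2 rfl]
    · simp only [if_neg h, rename, if_neg (fun h' => h ((hk j).1 h')), structSubst, ih hk]

theorem IsValue.rename {V : CTTerm} (h : IsValue V) (f g : ℕ → ℕ) : IsValue (V.rename f g) := by
  cases h <;> constructor

theorem IsValue.of_rename {V : CTTerm} {f g : ℕ → ℕ} (h : IsValue (V.rename f g)) :
    IsValue V := by
  cases V <;> first | constructor | cases h

theorem EqAxiom.rename {M N : CTTerm} (h : EqAxiom M N) (f g : ℕ → ℕ) :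
    EqAxiom (M.rename f g) (N.rename f g) := by
  cases h with
  | assoc L M N => simp only [CTTerm.rename, rename_shiftUnder]; exact .assoc _ _ _
  | epsLet M N => simp only [CTTerm.rename, rename_cshift]; exact .epsLet _ _
  | throwLet k M N => exact .throwLet _ _ _

theorem Rule.rename {M N : CTTerm} (h : Rule M N) (f g : ℕ → ℕ) :
    Rule (M.rename f g) (N.rename f g) := by
  cases h with
  | ad₁ N M h =>
    simp only [CTTerm.rename, rename_shift]; exact .ad₁ _ _ fun h' => h h'.of_rename
  | ad₂ V N hV h =>
    simp only [CTTerm.rename, rename_shift]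
    exact .ad₂ _ _ (hV.rename _ _) fun h' => h h'.of_rename
  | betaLam M V hV => exact .betaLam _ _ (hV.rename _ _)
  | betaLet M V hV => rw [rename_inst]; exact .betaLet _ _ (hV.rename _ _)
  | etaLam V h =>
    simp only [CTTerm.rename, rename_shift]; exact .etaLam _ (h.rename _ _)
  | etaLet M => exact .etaLet _
  | epsDummy M => simp only [CTTerm.rename, rename_cshift]; exact .epsDummy _
  | epsThrow M => exact .epsThrow _
  | letThrow M k N => exact .letThrow _ _ _
  | throwThrow l k N => exact .throwThrow _ _ _
  | letEps M N =>
    have hg : ∀ j, up g j = 0 ↔ j = 0 := fun j => by cases j <;> simp [up]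
    simp only [CTTerm.rename, rename_cshift, rename_structSubst hg]; exact .letEps _ _
  | throwEps l M => simp only [CTTerm.rename, rename_cinst]; exact .throwEps _ _
  | epsEps M => simp only [CTTerm.rename, rename_cinst]; exact .epsEps _

/-- Steps are stable under arbitrary renamings, including the non-injective one behind `cinst`. -/
theorem RawStep.rename {M N : CTTerm} (h : RawStep M N) (f g : ℕ → ℕ) :
    RawStep (M.rename f g) (N.rename f g) := by
  induction h generalizing f g with
  | rule h => exact .rule (h.rename f g)
  | lam _ ih => exact .lam (ih _ _)
  | appLeft _ _ ih => exact .appLeft _ (ih _ _)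
  | appRight _ _ ih => exact .appRight _ (ih _ _)
  | letLeft _ _ ih => exact .letLeft _ (ih _ _)
  | letRight _ _ ih => exact .letRight _ (ih _ _)
  | eps _ ih => exact .eps (ih _ _)
  | throw k _ ih => exact .throw _ (ih _ _)

theorem CongrGen.rename {R : CTTerm → CTTerm → Prop} (hR : ∀ {M N}, R M N → ∀ f g,
    R (M.rename f g) (N.rename f g)) {M N : CTTerm} (h : CongrGen R M N) (f g : ℕ → ℕ) :
    CongrGen R (M.rename f g) (N.rename f g) := by
  induction h generalizing f g with
  | base h => exact .base (hR h f g)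
  | refl M => exact .refl _
  | symm _ ih => exact .symm (ih _ _)
  | trans _ _ h1 h2 => exact .trans (h1 _ _) (h2 _ _)
  | lam _ ih => exact .lam (ih _ _)
  | app _ _ h1 h2 => exact .app (h1 _ _) (h2 _ _)
  | letIn _ _ h1 h2 => exact .letIn (h1 _ _) (h2 _ _)
  | eps _ ih => exact .eps (ih _ _)
  | throw k _ ih => exact .throw _ (ih _ _)

/-! ### Free continuation variables. -/

/-- The continuation variable `k` occurs free in the term. -/
def Occ : ℕ → CTTerm → Prop
  | _, var _ => False
  | k, lam M => Occ k M
  | k, app M N => Occ k M ∨ Occ k N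
  | k, letIn L M => Occ k L ∨ Occ k M
  | k, eps M => Occ (k + 1) M
  | k, throw j M => j = k ∨ Occ k M

theorem occ_rename {f g : ℕ → ℕ} {k : ℕ} {M : CTTerm} :
    Occ k (rename f g M) ↔ ∃ j, Occ j M ∧ g j = k := by
  induction M generalizing f g k with
  | var x => simp [rename, Occ]
  | lam M ih => simp only [rename, Occ, ih]
  | app M N ih1 ih2 => simp only [rename, Occ, ih1, ih2, or_and_right, exists_or]
  | letIn M N ih1 ih2 => simp only [rename, Occ, ih1, ih2, or_and_right, exists_or]
  | eps M ih =>
    simp only [rename, Occ, ih]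
    constructor
    · rintro ⟨_ | j, h, hj⟩
      · simp [up] at hj
      · exact ⟨j, h, by simpa [up] using hj⟩
    · rintro ⟨j, h, rfl⟩
      exact ⟨j + 1, h, rfl⟩
  | throw j M ih => simp [rename, Occ, ih, or_and_right, exists_or]

theorem rename_congr {f g g' : ℕ → ℕ} {M : CTTerm} (h : ∀ k, Occ k M → g k = g' k) :
    rename f g M = rename f g' M := by
  induction M generalizing f g g' with
  | var x => rfl
  | lam M ih => simp only [rename]; rw [ih h]
  | app M N ih1 ih2 =>
    simp only [rename]; rw [ih1 fun k hk => h k (.inl hk), ih2 fun k hk => h k (.inr hk)]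
  | letIn M N ih1 ih2 =>
    simp only [rename]; rw [ih1 fun k hk => h k (.inl hk), ih2 fun k hk => h k (.inr hk)]
  | eps M ih =>
    simp only [rename]
    rw [ih fun k hk => ?_]
    cases k with
    | zero => rfl
    | succ k => simp only [up]; rw [h k hk]
  | throw j M ih =>
    simp only [rename]; rw [ih fun k hk => h k (.inr hk), h j (.inl rfl)]

theorem occ_cshift_succ {k : ℕ} {M : CTTerm} : Occ (k + 1) (cshift M) ↔ Occ k M := by
  simp [cshift, occ_rename]

theorem not_occ_zero_cshift (M : CTTerm) : ¬ Occ 0 (cshift M) := by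
  simp [cshift, occ_rename]

theorem occ_shift {k : ℕ} {M : CTTerm} : Occ k (shift M) ↔ Occ k M := by
  simp [shift, occ_rename]

theorem occ_shiftUnder {k : ℕ} {M : CTTerm} : Occ k (shiftUnder M) ↔ Occ k M := by
  simp [shiftUnder, occ_rename]

theorem occ_of_occ_cinst {k l : ℕ} {M : CTTerm} (h : Occ k (cinst l M)) :
    Occ (k + 1) M ∨ k = l := by
  obtain ⟨_ | j, h, hj⟩ := occ_rename.1 h
  · exact .inr hj.symm
  · exact .inl (by rwa [← hj])

theorem cshift_cinst {M : CTTerm} (h : ¬ Occ 0 M) (l : ℕ) : cshift (cinst l M) = M := by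
  rw [cshift, cinst, rename_rename]
  conv_rhs => rw [← rename_id M]
  refine rename_congr fun k hk => ?_
  cases k with
  | zero => exact absurd hk h
  | succ k => rfl

theorem occ_of_occ_subst {s : ℕ → CTTerm} {k : ℕ} {M : CTTerm} (h : Occ k (subst s M)) :
    Occ k M ∨ ∃ n, Occ k (s n) := by
  have hup : ∀ {s : ℕ → CTTerm} {k}, (∃ n, Occ k (upSubst s n)) → ∃ n, Occ k (s n) := by
    rintro s k ⟨_ | n, h⟩
    · exact h.elim
    · exact ⟨n, occ_shift.1 h⟩
  induction M generalizing s k with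
  | var x => exact .inr ⟨x, h⟩
  | lam M ih => exact (ih h).imp_right hup
  | app M N ih1 ih2 =>
    rcases h with h | h
    · exact (ih1 h).imp_left .inl
    · exact (ih2 h).imp_left .inr
  | letIn M N ih1 ih2 =>
    rcases h with h | h
    · exact (ih1 h).imp .inl hup
    · exact (ih2 h).imp_left .inr
  | eps M ih => exact (ih h).imp_right fun ⟨n, hn⟩ => ⟨n, occ_cshift_succ.1 hn⟩
  | throw j M ih =>
    rcases h with h | h
    · exact .inl (.inl h)
    · exact (ih h).imp_left .inr

theorem occ_of_occ_structSubst {k j : ℕ} {L N : CTTerm} (h : Occ j (structSubst k L N)) :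
    Occ j N ∨ Occ j L := by
  induction N generalizing k j L with
  | var x => exact .inl h
  | lam M ih => exact (ih h).imp_right occ_shiftUnder.1
  | app M N ih1 ih2 =>
    rcases h with h | h
    · exact (ih1 h).imp_left .inl
    · exact (ih2 h).imp_left .inr
  | letIn M N ih1 ih2 =>
    rcases h with h | h
    · exact (ih1 h).imp .inl occ_shiftUnder.1
    · exact (ih2 h).imp_left .inr
  | eps M ih => exact (ih h).imp_right occ_cshift_succ.1
  | throw i M ih =>
    rw [structSubst] at h
    split at h
    · next hi =>
      subst hi
      rcases h with h | h | h
      · exact .inl (.inl h)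
      · exact .inr h
      · exact (ih h).imp_left .inr
    · rcases h with h | h
      · exact .inl (.inl h)
      · exact (ih h).imp_left .inr

/-- Reduction creates no free continuation variables, so a vacuous `ε` stays vacuous. -/
theorem Rule.occ {M N : CTTerm} (h : Rule M N) {k : ℕ} (hk : Occ k N) : Occ k M := by
  cases h with
  | ad₁ N M h => simp only [Occ, occ_shift] at hk ⊢; tauto
  | ad₂ V N hV h => simp only [Occ, occ_shift] at hk ⊢; tauto
  | betaLam M V hV => exact hk
  | betaLet M V hV =>
    rcases occ_of_occ_subst hk with h | ⟨_ | n, h⟩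
    · exact .inl h
    · exact .inr h
    · exact h.elim
  | etaLam V h => exact .inl (occ_shift.2 hk)
  | etaLet M => exact .inr hk
  | epsDummy M => exact occ_cshift_succ.2 hk
  | epsThrow M => exact .inr hk
  | letThrow M k N => exact .inr hk
  | throwThrow l k N => exact .inr hk
  | letEps M N =>
    rcases hk with h | h
    · exact .inl (occ_cshift_succ.1 h)
    · rcases occ_of_occ_structSubst h with h | h
      · exact .inr h
      · exact .inl (occ_cshift_succ.1 h)
  | throwEps l M =>
    rcases hk with rfl | h
    · exact .inl rfl
    · exact (occ_of_occ_cinst h).symm.imp_left Eq.symm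
  | epsEps M =>
    rcases occ_of_occ_cinst hk with h | h
    · exact h
    · cases h

theorem RawStep.occ {M N : CTTerm} (h : RawStep M N) {k : ℕ} (hk : Occ k N) : Occ k M := by
  induction h generalizing k with
  | rule h => exact h.occ hk
  | lam _ ih => exact ih hk
  | appLeft _ _ ih => exact hk.imp_left ih
  | appRight _ _ ih => exact hk.imp_right ih
  | letLeft _ _ ih => exact hk.imp_left ih
  | letRight _ _ ih => exact hk.imp_right ih
  | eps _ ih => exact ih hk
  | throw k _ ih => exact hk.imp_right ih

theorem EqAxiom.occ_iff {M N : CTTerm} (h : EqAxiom M N) {k : ℕ} : Occ k M ↔ Occ k N := by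
  cases h with
  | assoc L M N => simp only [Occ, occ_shiftUnder]; tauto
  | epsLet M N => simp only [Occ, occ_cshift_succ]
  | throwLet k M N => simp only [Occ]; tauto

theorem CongrGen.occ_iff {M N : CTTerm} (h : CongrGen EqAxiom M N) {k : ℕ} :
    Occ k M ↔ Occ k N := by
  induction h generalizing k with
  | base h => exact h.occ_iff
  | refl M => exact .rfl
  | symm _ ih => exact ih.symm
  | trans _ _ h1 h2 => exact h1.trans h2
  | lam _ ih => exact ih
  | app _ _ h1 h2 => exact or_congr h1 h2
  | letIn _ _ h1 h2 => exact or_congr h1 h2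
  | eps _ ih => exact ih
  | throw k _ ih => exact or_congr .rfl ih

/-! ### Reduction modulo the equality axioms, and constructors that omit trivial cases. -/

/-- Reduction of raw terms, interleaved with the equality axioms. -/
def Red : CTTerm → CTTerm → Prop :=
  Relation.ReflTransGen fun M N => CongrGen EqAxiom M N ∨ RawStep M N

namespace Red

theorem refl (M : CTTerm) : Red M M := Relation.ReflTransGen.refl
theorem trans {M N P : CTTerm} (h1 : Red M N) (h2 : Red N P) : Red M P :=
  Relation.ReflTransGen.trans h1 h2
theorem of_rule {M N : CTTerm} (h : Rule M N) : Red M N := .single (.inr (.rule h))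
theorem of_eqAxiom {M N : CTTerm} (h : EqAxiom M N) : Red M N := .single (.inl (.base h))

theorem lam {M M' : CTTerm} (h : Red M M') : Red (lam M) (lam M') :=
  h.lift _ fun _ _ => .imp .lam .lam

theorem app {M M' N N' : CTTerm} (h1 : Red M M') (h2 : Red N N') : Red (app M N) (app M' N') :=
  trans (h1.lift (fun M => CTTerm.app M N) fun _ _ => .imp (.app · (.refl _)) (.appLeft _))
    (h2.lift (fun N => CTTerm.app M' N) fun _ _ => .imp (.app (.refl _)) (.appRight _))

theorem letIn {M M' N N' : CTTerm} (h1 : Red M M') (h2 : Red N N') :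
    Red (letIn M N) (letIn M' N') :=
  trans (h1.lift (fun M => CTTerm.letIn M N) fun _ _ => .imp (.letIn · (.refl _)) (.letLeft _))
    (h2.lift (fun N => CTTerm.letIn M' N) fun _ _ => .imp (.letIn (.refl _)) (.letRight _))

theorem eps {M M' : CTTerm} (h : Red M M') : Red (eps M) (eps M') :=
  h.lift _ fun _ _ => .imp .eps .eps

theorem throw (k : ℕ) {M M' : CTTerm} (h : Red M M') : Red (throw k M) (throw k M') :=
  h.lift _ fun _ _ => .imp (.throw k) (.throw k)

theorem rename {M N : CTTerm} (h : Red M N) (f g : ℕ → ℕ) : Red (M.rename f g) (N.rename f g) :=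
  h.lift _ fun _ _ => .imp (.rename EqAxiom.rename · f g) (.rename · f g)

theorem occ {M N : CTTerm} (h : Red M N) {k : ℕ} (hk : Occ k N) : Occ k M := by
  induction h with
  | refl => exact hk
  | tail _ h ih => exact ih (h.elim (fun h => h.occ_iff.2 hk) fun h => h.occ hk)

theorem steps {M N : CTTerm} (h : Red M N) : CTClass.Steps (CTClass.mk M) (CTClass.mk N) := by
  induction h with
  | refl => exact .refl
  | @tail N P _ h ih =>
    rcases h with h | h
    · rwa [show CTClass.mk P = CTClass.mk N from (Quotient.sound h).symm]
    · exact ih.tail ⟨_, _, rfl, rfl, h⟩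

end Red

/-- `let` without the trivial case `x[x := N]`. -/
def mkLet : CTTerm → CTTerm → CTTerm
  | var 0, N => N
  | L, N => letIn L N

theorem mkLet_of_ne {L : CTTerm} (h : L ≠ var 0) (N : CTTerm) : mkLet L N = letIn L N := by
  unfold mkLet
  split
  · exact absurd rfl h
  · rfl

theorem Red.letIn_mkLet (L N : CTTerm) : Red (CTTerm.letIn L N) (mkLet L N) := by
  by_cases h : L = CTTerm.var 0
  · subst h; exact .of_rule (.etaLet N)
  · rw [mkLet_of_ne h]; exact .refl _

theorem Red.mkLet_right (L : CTTerm) {N N' : CTTerm} (h : Red N N') :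
    Red (mkLet L N) (mkLet L N') := by
  by_cases hL : L = CTTerm.var 0
  · subst hL; exact h
  · rw [mkLet_of_ne hL, mkLet_of_ne hL]; exact .letIn (.refl _) h

open Classical in
/-- `ε` without the case of a vacuous binder. -/
noncomputable def mkEps (T : CTTerm) : CTTerm := if Occ 0 T then eps T else cinst 0 T

theorem mkEps_of_occ {T : CTTerm} (h : Occ 0 T) : mkEps T = eps T := if_pos h
theorem mkEps_cshift (T : CTTerm) : mkEps (cshift T) = T :=
  (if_neg (not_occ_zero_cshift T)).trans (cinst_cshift 0 T)

theorem occ_or_eq_cshift (T : CTTerm) : Occ 0 T ∨ ∃ T', T = cshift T' := by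
  by_cases h : Occ 0 T
  · exact .inl h
  · exact .inr ⟨_, (cshift_cinst h 0).symm⟩

theorem Red.eps_mkEps (T : CTTerm) : Red (CTTerm.eps T) (mkEps T) := by
  rcases occ_or_eq_cshift T with h | ⟨T, rfl⟩
  · rw [mkEps_of_occ h]; exact .refl _
  · rw [mkEps_cshift]; exact .of_rule (.epsDummy T)

/-- A binder that becomes vacuous is dropped by `epsDummy`. One that is vacuous at the start remains
so, and the reduction is carried to the lowered terms by renaming. -/
theorem Red.mkEps {T T' : CTTerm} (h : Red T T') : Red (mkEps T) (mkEps T') := by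
  rcases occ_or_eq_cshift T with hT | ⟨T, rfl⟩
  · rw [mkEps_of_occ hT]; exact .trans (.eps h) (.eps_mkEps T')
  · rcases occ_or_eq_cshift T' with hT' | ⟨T', rfl⟩
    · exact absurd (h.occ hT') (not_occ_zero_cshift T)
    · rw [mkEps_cshift, mkEps_cshift]
      have := h.rename id fun n => match n with
        | 0 => 0
        | n + 1 => n
      change Red (cinst 0 _) (cinst 0 _) at this
      rwa [cinst_cshift, cinst_cshift] at this

/-- `throw` without the case of the current continuation, which has index `0`. -/
def mkThrow : ℕ → CTTerm → CTTerm
  | 0, T => T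
  | k + 1, T => throw (k + 1) T

theorem rename_eq_var_zero {f g : ℕ → ℕ} {L : CTTerm} :
    rename (up f) g L = var 0 ↔ L = var 0 := by
  cases L with
  | var n => cases n <;> simp [rename, up]
  | _ => simp [rename]

theorem rename_mkLet (f g : ℕ → ℕ) (L N : CTTerm) :
    rename f g (mkLet L N) = mkLet (rename (up f) g L) (rename f g N) := by
  by_cases h : L = var 0
  · subst h; rfl
  · rw [mkLet_of_ne h, mkLet_of_ne (fun h' => h (rename_eq_var_zero.1 h')), rename]

theorem rename_mkEps (f g : ℕ → ℕ) (T : CTTerm) :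
    rename f g (mkEps T) = mkEps (rename f (up g) T) := by
  rcases occ_or_eq_cshift T with h | ⟨T, rfl⟩
  · rw [mkEps_of_occ h, mkEps_of_occ (occ_rename.2 ⟨0, h, rfl⟩), rename]
  · rw [mkEps_cshift, rename_cshift, mkEps_cshift]

theorem rename_mkThrow (f g : ℕ → ℕ) (k : ℕ) (T : CTTerm) :
    rename f (up g) (mkThrow k T) = mkThrow (up g k) (rename f (up g) T) := by
  cases k <;> rfl

theorem subst_eq_var_zero {s : ℕ → CTTerm} {L : CTTerm} :
    subst (upSubst s) L = var 0 ↔ L = var 0 := by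
  have h : ∀ M, shift M ≠ var 0 := fun M => by cases M <;> simp [shift, rename]
  cases L with
  | var n => cases n <;> simp [subst, upSubst, h]
  | _ => simp [subst]

theorem subst_mkLet (s : ℕ → CTTerm) (L N : CTTerm) :
    subst s (mkLet L N) = mkLet (subst (upSubst s) L) (subst s N) := by
  by_cases h : L = var 0
  · subst h; rfl
  · rw [mkLet_of_ne h, mkLet_of_ne (fun h' => h (subst_eq_var_zero.1 h')), subst]

theorem occ_subst {s : ℕ → CTTerm} {k : ℕ} {M : CTTerm} (h : Occ k M) : Occ k (subst s M) := by
  induction M generalizing s k with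
  | var x => exact h.elim
  | lam M ih => exact ih h
  | app M N ih1 ih2 => exact h.imp ih1 ih2
  | letIn M N ih1 ih2 => exact h.imp ih1 ih2
  | eps M ih => exact ih h
  | throw j M ih => exact h.imp_right ih

theorem subst_cshift (s : ℕ → CTTerm) (M : CTTerm) :
    subst (fun n => cshift (s n)) (cshift M) = cshift (subst s M) :=
  (rename_subst (fun _ => rfl) M).symm

theorem subst_mkEps (s : ℕ → CTTerm) (T : CTTerm) :
    subst s (mkEps T) = mkEps (subst (fun n => cshift (s n)) T) := by
  rcases occ_or_eq_cshift T with h | ⟨T, rfl⟩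
  · rw [mkEps_of_occ h, mkEps_of_occ (occ_subst h), subst]
  · rw [mkEps_cshift, subst_cshift, mkEps_cshift]

theorem subst_mkThrow (s : ℕ → CTTerm) (k : ℕ) (T : CTTerm) :
    subst s (mkThrow k T) = mkThrow k (subst s T) := by
  cases k <;> rfl

/-! ### Simultaneous structural substitution. -/

/-- Lift a family of contexts under a continuation binder. -/
def upCtx (L : ℕ → CTTerm) : ℕ → CTTerm
  | 0 => var 0
  | k + 1 => cshift (L k)

/-- Simultaneous structural substitution `throw k □ ↦ throw (t k) ((L k)[x := □])`, without trivial
`let`s. -/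
def ksub : (ℕ → ℕ) → (ℕ → CTTerm) → CTTerm → CTTerm
  | _, _, var x => var x
  | t, L, lam N => lam (ksub t (fun k => shiftUnder (L k)) N)
  | t, L, app M N => app (ksub t L M) (ksub t L N)
  | t, L, letIn M N => letIn (ksub t (fun k => shiftUnder (L k)) M) (ksub t L N)
  | t, L, eps N => eps (ksub (up t) (upCtx L) N)
  | t, L, throw k N => throw (t k) (mkLet (L k) (ksub t L N))

theorem rename_ksub {f g g' t t' : ℕ → ℕ} {L L' : ℕ → CTTerm} (ht : ∀ k, g (t k) = t' (g' k))
    (hL : ∀ k, rename (up f) g (L k) = L' (g' k)) (N : CTTerm) :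
    rename f g (ksub t L N) = ksub t' L' (rename f g' N) := by
  have hs : ∀ {f g g' : ℕ → ℕ} {L L' : ℕ → CTTerm}, (∀ k, rename (up f) g (L k) = L' (g' k)) →
      ∀ k, rename (up (up f)) g (shiftUnder (L k)) = shiftUnder (L' (g' k)) :=
    fun h k => by rw [rename_shiftUnder, h]
  induction N generalizing f g g' t t' L L' with
  | var x => rfl
  | lam N ih => simp only [ksub, rename]; rw [ih (L' := fun k => shiftUnder (L' k)) ht (hs hL)]
  | app M N ih1 ih2 => simp only [ksub, rename, ih1 ht hL, ih2 ht hL]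
  | letIn M N ih1 ih2 => simp only [ksub, rename, ih2 ht hL]; rw [ih1 (L' := fun k => shiftUnder (L' k)) ht (hs hL)]
  | eps N ih =>
    simp only [ksub, rename]
    rw [ih (g' := up g') (t' := up t') (L' := upCtx L')]
    · intro k
      cases k with
      | zero => rfl
      | succ k => simp only [up, ht]
    · intro k
      cases k with
      | zero => rfl
      | succ k => simp only [up, upCtx, rename_cshift, hL]
  | throw k N ih => simp only [ksub, rename, rename_mkLet, ih ht hL, ht, hL]

theorem ksub_cshift (t : ℕ → ℕ) (L : ℕ → CTTerm) (N : CTTerm) :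
    ksub (up t) (upCtx L) (cshift N) = cshift (ksub t L N) := by
  unfold cshift
  refine (rename_ksub (fun k => ?_) (fun k => ?_) N).symm
  · rfl
  rw [up_id]; rfl

theorem ksub_var {L : ℕ → CTTerm} (hL : ∀ k, L k = var 0) (t : ℕ → ℕ) (N : CTTerm) :
    ksub t L N = rename id t N := by
  induction N generalizing t L with
  | var x => rfl
  | lam N ih => simp only [ksub, rename, up_id]; rw [ih fun k => by rw [hL]; rfl]
  | app M N ih1 ih2 => simp only [ksub, rename, ih1 hL, ih2 hL]
  | letIn M N ih1 ih2 =>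
    simp only [ksub, rename, up_id, ih2 hL]; rw [ih1 fun k => by rw [hL]; rfl]
  | eps N ih =>
    simp only [ksub, rename]
    rw [ih fun k => ?_]
    cases k with
    | zero => rfl
    | succ k => rw [upCtx, hL]; rfl
  | throw k N ih => simp only [ksub, rename, ih hL, hL]; rfl

theorem ksub_rename (t g : ℕ → ℕ) (L : ℕ → CTTerm) (N : CTTerm) :
    ksub t L (rename id g N) = ksub (t ∘ g) (L ∘ g) N := by
  induction N generalizing t g L with
  | var x => rfl
  | lam N ih => simp only [ksub, rename, up_id, ih]; rfl
  | app M N ih1 ih2 => simp only [ksub, rename, ih1, ih2]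
  | letIn M N ih1 ih2 => simp only [ksub, rename, up_id, ih1, ih2]; rfl
  | eps N ih =>
    simp only [ksub, rename, ih, up_comp]
    congr 2; funext k; cases k <;> rfl
  | throw k N ih => simp only [ksub, rename, ih]; rfl

theorem ksub_eq_var_zero {t : ℕ → ℕ} {L : ℕ → CTTerm} {M : CTTerm} :
    ksub t L M = var 0 ↔ M = var 0 := by
  cases M <;> simp [ksub]

theorem ksub_mkLet (t : ℕ → ℕ) (L : ℕ → CTTerm) (M N : CTTerm) :
    ksub t L (mkLet M N) = mkLet (ksub t (fun k => shiftUnder (L k)) M) (ksub t L N) := by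
  by_cases h : M = var 0
  · subst h; rfl
  · rw [mkLet_of_ne h, mkLet_of_ne (fun h' => h (ksub_eq_var_zero.1 h')), ksub]

theorem Red.ksub_mkEps (t : ℕ → ℕ) (L : ℕ → CTTerm) (T : CTTerm) :
    Red (ksub t L (CTTerm.mkEps T)) (CTTerm.mkEps (ksub (up t) (upCtx L) T)) := by
  rcases occ_or_eq_cshift T with h | ⟨T, rfl⟩
  · rw [mkEps_of_occ h]; exact .eps_mkEps _
  · rw [mkEps_cshift, ksub_cshift, mkEps_cshift]; exact .refl _

/-- The condition `L k ≠ var 0` matters: `structSubst` inserts a `let` even for the trivial context,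
whereas `ksub` omits it. -/
theorem rename_structSubst_eq_ksub {k : ℕ} {g : ℕ → ℕ} {L : ℕ → CTTerm} {L₀ : CTTerm}
    (h₀ : L k = rename id g L₀) (hne : L k ≠ var 0) (hL : ∀ j, j ≠ k → L j = var 0) (N : CTTerm) :
    rename id g (structSubst k L₀ N) = ksub g L N := by
  have hs : ∀ {k : ℕ} {g : ℕ → ℕ} {L : ℕ → CTTerm} {L₀ : CTTerm}, L k = rename id g L₀ →
      shiftUnder (L k) = rename id g (shiftUnder L₀) := fun h => by
    rw [h]; refine rename_comm (fun n => ?_) (fun n => ?_) _ <;> cases n <;> rfl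
  have hn : ∀ {M}, M ≠ var 0 → shiftUnder M ≠ var 0 := fun h h' => h (rename_eq_var_zero.1 h')
  have hv : ∀ {M}, M = var 0 → shiftUnder M = var 0 := fun h => by rw [h]; rfl
  induction N generalizing k g L L₀ with
  | var x => rfl
  | lam N ih =>
    simp only [structSubst, ksub, rename, up_id]
    rw [ih (hs h₀) (hn hne) fun j hj => hv (hL j hj)]
  | app M N ih1 ih2 => simp only [structSubst, ksub, rename, ih1 h₀ hne hL, ih2 h₀ hne hL]
  | letIn M N ih1 ih2 =>
    simp only [structSubst, ksub, rename, up_id, ih2 h₀ hne hL]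
    rw [ih1 (hs h₀) (hn hne) fun j hj => hv (hL j hj)]
  | eps N ih =>
    simp only [structSubst, ksub, rename]
    rw [ih (L := upCtx L)]
    · rw [rename_cshift, ← h₀, upCtx]
    · exact fun h => hne ((cinst_cshift 0 (L k)).symm.trans (congrArg (cinst 0) h))
    · intro j hj
      cases j with
      | zero => rfl
      | succ j => rw [upCtx, hL j (by omega)]; rfl
  | throw j N ih =>
    rw [structSubst]
    split
    · next h => subst h; rw [ksub, mkLet_of_ne hne, h₀, rename, rename, up_id, ih h₀ hne hL]
    · next h => simp only [rename, ksub, ih h₀ hne hL, hL j h]; rfl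

/-! ### The inverse translation and its behaviour under substitution. -/

open Tm (bsub kcons kset upV upL upK upKL ren vsub scons binst cps)

/-- The continuation that a command finally returns to. -/
def tail : {b : Bool} → Tm b → ℕ
  | _, .var _ => 0
  | _, .lam _ => 0
  | _, .ret k _ => k
  | _, .bind _ _ P => tail P

/-- The inverse translation, without the final `throw` to `tail`. -/
noncomputable def body : {b : Bool} → Tm b → CTTerm
  | _, .var x => var x
  | _, .lam P => lam (mkEps (mkThrow (tail P) (body P)))
  | _, .ret _ V => body V
  | _, .bind V W P => mkLet (body P) (app (body V) (body W))

/-- The inverse translation of a command, which binds its current continuation. -/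
noncomputable def full (P : Tm false) : CTTerm := mkEps (mkThrow (tail P) (body P))

theorem tail_ren (f g : ℕ → ℕ) : ∀ P : Tm false, tail (ren f g P) = g (tail P)
  | .ret _ _ => rfl
  | .bind _ _ P => tail_ren (up f) g P

theorem tail_vsub (s : ℕ → Tm true) (g : ℕ → ℕ) : ∀ P : Tm false, tail (vsub s g P) = g (tail P)
  | .ret _ _ => rfl
  | .bind _ _ P => tail_vsub (upV s) g P

theorem tail_bsub (s : ℕ → Tm true) (t : ℕ → Tm false) :
    ∀ P : Tm false, tail (bsub s t P) = tail (t (tail P))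
  | .ret _ _ => tail_vsub _ _ _
  | .bind _ _ P => (tail_bsub (upV s) (upK t) P).trans (tail_ren _ _ _)

theorem body_ren {b : Bool} (f g : ℕ → ℕ) (M : Tm b) : body (ren f g M) = rename f g (body M) := by
  induction M generalizing f g with
  | var x => rfl
  | lam P ih => simp only [ren, body, rename, rename_mkEps, rename_mkThrow, ih, tail_ren]
  | ret k V ih => exact ih f g
  | bind V W P h1 h2 h3 => simp only [ren, body, rename_mkLet, rename, h1, h2, h3]

theorem full_ren (f g : ℕ → ℕ) (P : Tm false) : full (ren f (up g) P) = rename f g (full P) := by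
  simp only [full, rename_mkEps, rename_mkThrow, body_ren, tail_ren]

theorem isValue_body (V : Tm true) : IsValue (body V) := by
  cases V <;> constructor

theorem body_upV (s : ℕ → Tm true) (n : ℕ) : body (upV s n) = upSubst (fun n => body (s n)) n := by
  cases n with
  | zero => rfl
  | succ n => exact body_ren _ _ _

theorem body_upL (s : ℕ → Tm true) (n : ℕ) :
    body (upL s n) = cshift (upSubst (fun n => body (s n)) n) := by
  cases n with
  | zero => rfl
  | succ n =>
    rw [upL, body_ren, upSubst, cshift, shift, rename_rename]
    rfl

theorem body_vsub {b : Bool} (s : ℕ → Tm true) (M : Tm b) :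
    body (vsub s id M) = subst (fun n => body (s n)) (body M) := by
  induction M generalizing s with
  | var x => rfl
  | lam P ih =>
    simp only [vsub, body, subst, subst_mkEps, subst_mkThrow, up_id, ih, tail_vsub, body_upL, id]
  | ret k V ih => exact ih s
  | bind V W P h1 h2 h3 =>
    simp only [vsub, body, subst_mkLet, subst, h1, h2, h3, body_upV]

theorem body_vsub_scons {b : Bool} (V : Tm true) (M : Tm b) :
    body (vsub (scons V) id M) = inst (body V) (body M) := by
  rw [body_vsub, inst]
  congr 1; funext n; cases n <;> rfl

theorem full_vsub_scons (V : Tm true) (Q : Tm false) :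
    full (vsub (scons (ren id Nat.succ V)) id Q) = inst (body V) (full Q) := by
  rw [full, full, body_vsub, tail_vsub, inst, subst_mkEps, subst_mkThrow]
  congr 3; funext n
  cases n with
  | zero => exact body_ren _ _ _
  | succ n => rfl

theorem Red.mkLet_inst (L : CTTerm) {V : CTTerm} (hV : IsValue V) : Red (mkLet L V) (inst V L) := by
  by_cases h : L = CTTerm.var 0
  · subst h; exact .refl _
  · rw [mkLet_of_ne h]; exact .of_rule (.betaLet _ _ hV)

/-- Only a bare return of the bound variable gives a trivial `let`, so the cases of `mkLet` can be
read off the target command. -/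
theorem body_eq_var_zero {P : Tm false} (h : body P = var 0) : ∃ k, P = .ret k (.var 0) := by
  cases P with
  | ret k V =>
    cases V with
    | var x => cases h; exact ⟨k, rfl⟩
    | lam => cases h
  | bind V W P =>
    by_cases hP : body P = var 0
    · rw [body, hP] at h; cases h
    · rw [body, mkLet_of_ne hP] at h; cases h

/-- The associativity axiom, in a form that tolerates a trivial outer `let`. -/
theorem Red.mkLet_mkLet {L A : CTTerm} (h : A ≠ CTTerm.var 0) {B : CTTerm} (N : CTTerm)
    (hB : Red (mkLet (shiftUnder L) A) B) : Red (mkLet L (mkLet A N)) (mkLet B N) := by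
  refine .trans ?_ ((Red.letIn hB (.refl N)).trans (.letIn_mkLet _ _))
  rw [mkLet_of_ne h]
  by_cases hL : L = CTTerm.var 0
  · subst hL; exact .refl _
  · rw [mkLet_of_ne hL, mkLet_of_ne (L := shiftUnder L) fun h' => hL (rename_eq_var_zero.1 h')]
    exact .of_eqAxiom (.assoc _ _ _)

theorem mkThrow_ne {k : ℕ} (h : k ≠ 0) (T : CTTerm) : mkThrow k T = throw k T := by
  cases k with
  | zero => exact absurd rfl h
  | succ k => rfl

/-- The inverse translation turns substitution for continuations into structural substitution. -/
theorem body_bsub {b : Bool} (t : ℕ → Tm false) (M : Tm b) :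
    Red (mkLet (bif b then var 0 else body (t (tail M)))
      (ksub (fun k => tail (t k)) (fun k => body (t k)) (body M))) (body (bsub .var t M)) := by
  have hK : ∀ t : ℕ → Tm false, (fun k => shiftUnder (body (t k))) = fun k => body (upK t k) :=
    fun t => funext fun k => (body_ren _ _ _).symm
  have hT : ∀ t : ℕ → Tm false, (fun k => tail (upK t k)) = fun k => tail (t k) :=
    fun t => funext fun k => tail_ren _ _ _
  induction M generalizing t with
  | var x => exact .refl _
  | lam P ih =>
    refine .lam (.trans (.ksub_mkEps _ _ _) (.mkEps ?_))
    have h1 : up (fun k => tail (t k)) = fun k => tail (upKL t k) := by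
      funext k; cases k
      · rfl
      · exact (tail_ren _ _ _).symm
    have h2 : upCtx (fun k => shiftUnder (body (t k))) = fun k => body (upKL t k) := by
      funext k; cases k
      · rfl
      · rw [upCtx, upKL, body_ren, cshift, shiftUnder, rename_rename]; rfl
    have h := ih (upKL t)
    rw [h1, h2, Tm.upL_id, tail_bsub]
    generalize tail P = j at h ⊢
    -- A final return to the continuation of the abstraction itself needs no `throw`. Any other
    -- continuation stays nonzero after lifting, so its `throw` is kept on both sides.
    rcases j with _ | j
    · exact h
    · have hj : tail (upKL t (j + 1)) ≠ 0 := by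
        rw [upKL, tail_ren]; exact Nat.succ_ne_zero _
      rw [mkThrow_ne hj]
      exact .throw _ h
  | ret k V ih =>
    refine .trans (.mkLet_right _ (ih t)) ?_
    rw [bsub, body_vsub_scons]
    exact .mkLet_inst _ (isValue_body _)
  | bind V W P h1 h2 h3 =>
    have hN : Red (ksub (fun k => tail (t k)) (fun k => body (t k)) (app (body V) (body W)))
        (app (body (bsub .var t V)) (body (bsub .var t W))) := .app (h1 t) (h2 t)
    have h := h3 (upK t)
    -- If `P` merely returns its variable, then `t k` takes its place directly; otherwise two nested
    -- lets are reassociated.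
    by_cases hP : body P = var 0
    · obtain ⟨k, rfl⟩ := body_eq_var_zero hP
      have e : bsub .var t (.bind V W (.ret k (.var 0))) =
          .bind (bsub .var t V) (bsub .var t W) (t k) := by rw [bsub, Tm.bsub_upV_ret]
      rw [e]
      exact .mkLet_right _ hN
    · rw [body, ksub_mkLet, hK, bsub, Tm.upV_id]
      refine .trans (.mkLet_mkLet (fun h => hP (ksub_eq_var_zero.1 h)) _ ?_) (.mkLet_right _ hN)
      rw [hT] at h
      refine cast (congrArg (fun L => Red (mkLet L _) _) ?_) h
      exact body_ren _ _ _

/-! ### Simulation of target steps by source reductions. -/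

/-- `Y` represents the command `Q` with or without the final `throw`, which may be left out if it
is to the current continuation `t`. -/
def Rep (t : ℕ) (Q : Tm false) (Y : CTTerm) : Prop :=
  Y = throw (tail Q) (body Q) ∨ tail Q = t ∧ Y = body Q

/-- `Z`, in a context with the current continuation `t`, reduces to a representation of `Q`,
possibly after merging an `ε` with the context. -/
def Simulates (t : ℕ) (Z : CTTerm) (Q : Tm false) : Prop :=
  ∃ Y, Rep t Q Y ∧ (Red Z Y ∨ ∃ X, Red Z (eps X) ∧ Red (cinst t X) Y)

theorem Red.mkEps_throw (t : ℕ) (T : CTTerm) :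
    Red (CTTerm.mkEps (CTTerm.throw t T)) (CTTerm.mkEps (mkThrow t T)) := by
  cases t with
  | zero =>
    rw [mkEps_of_occ (T := CTTerm.throw 0 T) (Or.inl rfl)]
    exact .trans (.of_rule (.epsThrow T)) (.eps_mkEps T)
  | succ t => exact .refl _

theorem Rep.mkEps {Q : Tm false} {Y : CTTerm} (h : Rep 0 Q Y) : Red (CTTerm.mkEps Y) (full Q) := by
  rcases h with rfl | ⟨h, rfl⟩
  · exact .mkEps_throw _ _
  · rw [full, h]; exact .refl _

theorem Rep.throw {t : ℕ} {Q : Tm false} {Y : CTTerm} (h : Rep t Q Y) :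
    Red (CTTerm.throw t Y) (CTTerm.throw (tail Q) (body Q)) := by
  rcases h with rfl | ⟨rfl, rfl⟩
  · exact .of_rule (.throwThrow _ _ _)
  · exact .refl _

/-- For `t = 0` a pending `ε` meets the enclosing `ε` and merges by `epsEps`; otherwise it meets a
`throw` and merges by `throwEps`. -/
theorem Simulates.red_full {t : ℕ} {Z : CTTerm} {Q : Tm false} (h : Simulates t Z Q) :
    Red (mkEps (mkThrow t Z)) (full Q) := by
  obtain ⟨Y, hY, h⟩ := h
  rcases t with _ | t
  · rcases h with h | ⟨X, hX, h⟩
    · exact .trans (.mkEps h) hY.mkEps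
    · refine .trans (.mkEps hX) (.trans ?_ hY.mkEps)
      refine .trans (N := eps (cinst 0 X)) ?_ (.trans (.eps h) (.eps_mkEps Y))
      by_cases h0 : Occ 0 (eps X)
      · rw [mkEps_of_occ h0]; exact .of_rule (.epsEps X)
      -- With the outer binder vacuous, index `1` does not occur in `X`, and it is the only index at
      -- which the two renamings differ.
      · have e : mkEps (eps X) = eps (cinst 0 X) := by
          rw [mkEps, if_neg h0, cinst, cinst, rename]
          congr 1
          refine rename_congr fun k hk => ?_
          rcases k with _ | _ | k
          · rfl
          · exact absurd hk h0
          · rfl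
        rw [e]; exact .refl _
  · refine .trans (.mkEps (.trans ?_ hY.throw)) (.mkEps_throw _ _)
    rcases h with h | ⟨X, hX, h⟩
    · exact .throw _ h
    · exact .trans (.throw _ hX) (.trans (.of_rule (.throwEps _ X)) (.throw _ h))

theorem Simulates.of_red {t : ℕ} {Z Z' : CTTerm} {Q : Tm false} (hZ : Red Z Z')
    (h : Simulates t Z' Q) : Simulates t Z Q := by
  obtain ⟨Y, hY, h⟩ := h
  exact ⟨Y, hY, h.imp hZ.trans fun ⟨X, hX, h⟩ => ⟨X, hZ.trans hX, h⟩⟩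

theorem cinst_letIn (l : ℕ) (A B : CTTerm) :
    cinst l (letIn A B) = letIn (cinst l A) (cinst l B) := by
  simp only [cinst, rename, up_id]

/-- The axioms `epsLet` and `throwLet` move a pending `ε` or `throw` out of the enclosing `let`,
where it can still be merged or erased. -/
theorem Simulates.bind {t : ℕ} {Z : CTTerm} {Q : Tm false} (h : Simulates t Z Q) (V W : Tm true) :
    Simulates t (letIn Z (app (body V) (body W))) (.bind V W Q) := by
  obtain ⟨Y, hY, h⟩ := h
  have hY' : ∃ Y', Rep t (.bind V W Q) Y' ∧ Red (letIn Y (app (body V) (body W))) Y' := by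
    rcases hY with rfl | ⟨hQ, rfl⟩
    · exact ⟨_, .inl rfl, .trans (.of_eqAxiom (.throwLet _ _ _)) (.throw _ (.letIn_mkLet _ _))⟩
    · exact ⟨_, .inr ⟨hQ, rfl⟩, .letIn_mkLet _ _⟩
  obtain ⟨Y', hR, hY'⟩ := hY'
  refine ⟨Y', hR, h.imp (fun h => .trans (.letIn h (.refl _)) hY') ?_⟩
  rintro ⟨X, hX, h⟩
  refine ⟨letIn X (cshift (app (body V) (body W))),
    .trans (.letIn hX (.refl _)) (.of_eqAxiom (.epsLet _ _)), .trans ?_ hY'⟩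
  refine .trans (N := letIn (cinst t X) (cinst t (cshift (app (body V) (body W))))) ?_ ?_
  · rw [cinst_letIn]; exact .refl _
  · rw [cinst_cshift]; exact .letIn h (.refl _)

/-- A `let` whose argument is the inverse translation of a command simulates the substitution for
the current continuation of that command. -/
theorem simulates_mkLet_full (P Q : Tm false) :
    Simulates (tail P) (mkLet (body P) (full Q)) (bsub .var (kcons P) Q) := by
  set t : ℕ → ℕ := fun k => tail (kcons P k)
  set L : ℕ → CTTerm := fun k => body (kcons P k)
  -- Merging the resulting `ε` into `tail P` is the same renaming of continuations as substituting
  -- `P` for index `0`.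
  have hc : ∀ M, cinst (tail P) M = rename id t M := fun M =>
    congrArg (fun g => rename id g M) (funext fun k => by cases k <;> rfl)
  obtain ⟨R, hR⟩ : ∃ R, R = mkThrow (tail Q) (body Q) := ⟨_, rfl⟩
  have hmain : ∃ Y, Rep (tail P) (bsub .var (kcons P) Q) Y ∧
      Red (mkLet (body P) (ksub t L R)) Y := by
    have h := body_bsub (kcons P) Q
    have h' := tail_bsub .var (kcons P) Q
    generalize tail Q = j at h h' hR
    subst hR
    rcases j with _ | j
    · exact ⟨_, .inr ⟨h', rfl⟩, h⟩
    · refine ⟨_, .inl rfl, ?_⟩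
      rw [h']
      have h1 : Red (ksub t L (throw (j + 1) (body Q))) (throw j (body (bsub .var (kcons P) Q))) := .throw j h
      refine .trans (.mkLet_right _ h1) ?_
      -- Here `Q` finally returns elsewhere than to `P`, so the pending `let` with body `P` is
      -- discarded by `letThrow`.
      by_cases hP : body P = var 0
      · rw [hP]; exact .refl _
      · rw [mkLet_of_ne hP]; exact .of_rule (.letThrow _ _ _)
  obtain ⟨Y, hY, hmain⟩ := hmain
  refine ⟨Y, hY, ?_⟩
  rw [full, ← hR]
  -- If the current continuation is thrown to, a genuine `ε` remains, which `letEps` carries past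
  -- the `let` unless that is trivial. Otherwise there is no `ε`, and the structural substitution
  -- does nothing.
  rcases occ_or_eq_cshift R with h0 | ⟨R', hR'⟩
  · right
    rw [mkEps_of_occ h0]
    by_cases hP : body P = var 0
    · refine ⟨R, ?_, .trans ?_ hmain⟩
      · rw [hP]; exact .refl _
      · rw [hP, ksub_var (fun k => by cases k; exacts [hP, rfl])]
        rw [hc]
        exact .refl _
    · rw [mkLet_of_ne hP] at hmain ⊢
      refine ⟨_, .of_rule (.letEps _ _), .trans ?_ hmain⟩
      have e := rename_structSubst_eq_ksub (k := 0) (g := t) (L := L) (L₀ := cshift (body P))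
        (by rw [← hc, cinst_cshift]; rfl) hP (fun j hj => by cases j; exacts [absurd rfl hj, rfl]) R
      rw [cinst_letIn, cinst_cshift, hc, e]
      exact .refl _
  · left
    rw [hR'] at hmain ⊢
    rw [mkEps_cshift]
    rw [cshift, ksub_rename, ksub_var (L := L ∘ Nat.succ) (fun _ => rfl)] at hmain
    exact cast (congrArg (fun M => Red (mkLet (body P) M) Y) (rename_id R')) hmain

/-- The simulation statement for values and for commands. -/
def Sim : {b : Bool} → Tm b → Tm b → Prop
  | true, V, V' => Red (body V) (body V')
  | false, P, P' => Simulates (tail P) (body P) P'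

theorem Sim.of_step {b : Bool} {M N : Tm b} (h : Tm.Step M N) : Sim M N := by
  induction h with
  | lam _ ih => exact Red.lam (Simulates.red_full ih)
  | ret k _ ih => exact ⟨_, .inr ⟨rfl, rfl⟩, .inl ih⟩
  | bindFun W P _ ih => exact ⟨_, .inr ⟨rfl, rfl⟩, .inl (.mkLet_right _ (.app ih (.refl _)))⟩
  | bindArg V P _ ih => exact ⟨_, .inr ⟨rfl, rfl⟩, .inl (.mkLet_right _ (.app (.refl _) ih))⟩
  | @bindBody V W P P' h ih =>
    -- A command that only returns a variable has no step, so the `let` is a genuine one.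
    have hP : body P ≠ var 0 := by
      intro hP
      obtain ⟨k, rfl⟩ := body_eq_var_zero hP
      cases h with
      | ret _ h => cases h
    rw [Sim, body, mkLet_of_ne hP]
    exact Simulates.bind ih V W
  | beta Q V P =>
    -- The contraction is split into value substitution, done in the source by `betaLam` and
    -- `betaLet`, and then continuation substitution.
    have e : binst Q V P = bsub .var (kcons P) (vsub (scons (ren id Nat.succ V)) id Q) := by
      rw [binst, Tm.bsub_vsub]
      refine Tm.bsub_congr (fun n => ?_) (fun k => rfl) Q
      cases n with
      | zero => exact (Tm.bsub_ren Tm.var (kcons P) id Nat.succ V).trans (Tm.bsub_id V) |>.symm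
      | succ n => rfl
    rw [e]
    refine (simulates_mkLet_full P _).of_red (.mkLet_right _ ?_)
    rw [full_vsub_scons]
    exact .trans (.of_rule (.betaLam _ _ (isValue_body V)))
      (.of_rule (.betaLet _ _ (isValue_body V)))
  | eta V =>
    have e : body (ren Nat.succ Nat.succ V) = cshift (shift (body V)) := by
      rw [body_ren, cshift, shift, rename_rename]; rfl
    have e' : body (Tm.etaExp V) = lam (app (shift (body V)) (var 0)) := by
      change lam (mkEps (app (body (ren Nat.succ Nat.succ V)) (cshift (var 0)))) = _
      rw [e]
      exact congrArg lam (mkEps_cshift (app (shift (body V)) (var 0)))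
    rw [Sim, e']
    exact .of_rule (.etaLam _ (isValue_body V))

theorem Red.full_of_par {P Q : Tm false} (h : Relation.ReflTransGen Tm.Par P Q) :
    Red (full P) (full Q) := by
  have hs : ∀ {P Q : Tm false}, Relation.ReflTransGen Tm.Step P Q → Red (full P) (full Q) := by
    intro P Q h
    induction h with
    | refl => exact .refl _
    | tail _ h ih => exact ih.trans (Simulates.red_full (Sim.of_step h))
  induction h with
  | refl => exact .refl _
  | tail _ h ih => exact ih.trans (hs h.steps)

/-! ### Every term reduces to the inverse translation of its translation. -/

/-- When the binder is vacuous, any `l` may be instantiated for it. So both cases lead to `cinst l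
R` under an `ε` with `l = 0`, or under `throw l`. -/
theorem mkEps_cases (R : CTTerm) (l : ℕ) : mkEps R = eps R ∨ mkEps R = cinst l R := by
  rcases occ_or_eq_cshift R with h | ⟨R, rfl⟩
  · exact .inl (mkEps_of_occ h)
  · exact .inr (by rw [mkEps_cshift, cinst_cshift])

theorem rep_rename (g : ℕ → ℕ) (t : ℕ) (hg : g 0 = t) (P : Tm false) :
    Rep t (ren id g P) (rename id g (mkThrow (tail P) (body P))) := by
  rw [Rep, tail_ren, body_ren]
  generalize tail P = j
  cases j with
  | zero => exact .inr ⟨hg, rfl⟩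
  | succ j => exact .inl rfl

theorem Red.letIn_mkEps (R N : CTTerm) :
    Red (CTTerm.letIn (CTTerm.mkEps R) N) (CTTerm.mkEps (CTTerm.letIn R (cshift N))) := by
  rcases occ_or_eq_cshift R with h | ⟨R, rfl⟩
  · rw [mkEps_of_occ h]
    exact .trans (.of_eqAxiom (.epsLet _ _)) (.eps_mkEps _)
  · have e : CTTerm.letIn (cshift R) (cshift N) = cshift (CTTerm.letIn R N) := by
      simp only [cshift, CTTerm.rename, up_id]
    rw [mkEps_cshift, e, mkEps_cshift]
    exact .refl _

theorem Red.letIn_mkThrow (t : ℕ) (T N : CTTerm) :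
    Red (CTTerm.letIn (mkThrow t T) N) (mkThrow t (mkLet T N)) := by
  cases t with
  | zero => exact .letIn_mkLet _ _
  | succ t => exact .trans (.of_eqAxiom (.throwLet _ _ _)) (.throw _ (.letIn_mkLet _ _))

theorem Red.letIn_full {L N : CTTerm} (hL : Red L (full (cps L))) (hN : Red N (full (cps N))) :
    Red (CTTerm.letIn L N) (full (cps (CTTerm.letIn L N))) := by
  refine .trans (.letIn hL hN) ?_
  rw [cps]
  generalize cps L = A, cps N = B
  -- `kset` keeps the index `0` of `A` in place. Making room for it in `B` first turns this into the
  -- removal of a binder, as in a beta-contraction.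
  have e : bsub .var (kset A) B = bsub .var (kcons A) (ren id (up Nat.succ) B) := by
    rw [Tm.bsub_ren]
    exact Tm.bsub_congr (fun _ => rfl) (fun k => by cases k <;> rfl) B
  rw [e]
  refine .trans (.letIn_mkEps _ _) (.trans (.mkEps (.letIn_mkThrow _ _ _)) ?_)
  rw [cshift, ← full_ren]
  exact (simulates_mkLet_full A _).red_full

theorem full_value {V : CTTerm} (hV : IsValue V) : full (cps V) = body (Tm.cval V) := by
  rw [Tm.cps_value hV, full, body, body_ren]
  exact mkEps_cshift _

theorem Red.shift_full {M : CTTerm} (h : Red M (full (cps M))) :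
    Red (shift M) (full (cps (shift M))) := by
  rw [shift, Tm.cps_rename, full_ren]
  exact h.rename _ _

/-- Applications of values to values are preserved as they are; a non-value argument is first named
by `ad₂`, which the translation does not see. -/
theorem Red.app_value_full {V N : CTTerm} (hV : IsValue V) (h1 : Red V (full (cps V)))
    (h2 : Red N (full (cps N))) : Red (CTTerm.app V N) (full (cps (CTTerm.app V N))) := by
  have hval : ∀ {V W : CTTerm}, IsValue V → IsValue W → Red V (full (cps V)) →
      Red W (full (cps W)) → Red (CTTerm.app V W) (full (cps (CTTerm.app V W))) := by
    intro V W hV hW h1 h2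
    rw [full_value hV] at h1
    rw [full_value hW] at h2
    have e : full (cps (CTTerm.app V W)) = CTTerm.app (body (Tm.cval V)) (body (Tm.cval W)) := by
      rw [Tm.cps_app_value hV hW, full, body, body_ren, body_ren]
      exact mkEps_cshift (CTTerm.app (body (Tm.cval V)) (body (Tm.cval W)))
    rw [e]
    exact .app h1 h2
  by_cases hN : IsValue N
  · exact hval hV hN h1 h2
  · refine .trans (.of_rule (.ad₂ V N hV hN)) ?_
    rw [Tm.cps_app_value_nonvalue hV]
    exact .letIn_full (hval (hV.rename _ _) (.var 0) h1.shift_full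
      (by rw [full_value (.var 0)]; exact .refl _)) h2

/-- Structural induction on `M`: the administrative rules name non-values, and nested `ε` and
`throw` are merged as in the inverse translation. -/
theorem red_full_cps (M : CTTerm) : Red M (full (cps M)) := by
  induction M with
  | var x => rw [full_value (.var x)]; exact .refl _
  | lam M ih => rw [full_value (.lam M)]; exact .lam ih
  | app M N ih1 ih2 =>
    by_cases hM : IsValue M
    · exact .app_value_full hM ih1 ih2
    · refine .trans (.of_rule (.ad₁ M N hM)) ?_
      rw [Tm.cps_app_nonvalue]
      refine .letIn_full (.app_value_full (.var 0) ?_ ih2.shift_full) ih1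
      rw [full_value (.var 0)]; exact .refl _
  | letIn L M ih1 ih2 => exact .letIn_full ih1 ih2
  | eps M ih =>
    have h := rep_rename Nat.pred 0 rfl (cps M)
    have e : cinst 0 (mkThrow (tail (cps M)) (body (cps M))) =
        rename id Nat.pred (mkThrow (tail (cps M)) (body (cps M))) :=
      congrArg (fun g => rename id g _) (funext fun k => by cases k <;> rfl)
    refine .trans (.eps ih) (.trans ?_ (.trans (.eps_mkEps _) h.mkEps))
    rw [← e]
    rcases mkEps_cases (mkThrow (tail (cps M)) (body (cps M))) 0 with h' | h'
    · rw [full, h']; exact .of_rule (.epsEps _)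
    · rw [full, h']; exact .refl _
  | throw k M ih =>
    obtain ⟨g, hg⟩ : ∃ g : ℕ → ℕ, g = fun n => match n with
      | 0 => k
      | n + 1 => n := ⟨_, rfl⟩
    have h := rep_rename g k (by rw [hg]) (cps M)
    have e : ∀ T, cinst k T = rename id g T := fun T => by rw [hg]; rfl
    have e' : full (cps (CTTerm.throw k M)) =
        CTTerm.throw (tail (ren id g (cps M))) (body (ren id g (cps M))) := by
      have hthr : cps (CTTerm.throw k M) = ren id Nat.succ (ren id g (cps M)) := by
        rw [cps, Tm.ren_ren, hg]
        exact Tm.ren_congr (fun _ => rfl) (fun k => by cases k <;> rfl) _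
      rw [hthr, full, tail_ren, body_ren]
      exact mkEps_cshift (CTTerm.throw (tail (ren id g (cps M))) (body (ren id g (cps M))))
    rw [e']
    refine .trans (.throw k ih) (.trans ?_ h.throw)
    rw [← e]
    rcases mkEps_cases (mkThrow (tail (cps M)) (body (cps M))) k with h' | h'
    · rw [full, h']; exact .of_rule (.throwEps _ _)
    · rw [full, h']; exact .refl _

end CTTerm

theorem mainTheorem10 (M N : CTTerm) (h : CTTerm.Conv M N) :
    ∃ P : CTClass, CTClass.Steps (CTClass.mk M) P ∧ CTClass.Steps (CTClass.mk N) P := by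
  obtain ⟨Q, h1, h2⟩ := Tm.cv_of_conv h
  exact ⟨CTClass.mk (CTTerm.full Q),
    ((CTTerm.red_full_cps M).trans (CTTerm.Red.full_of_par h1)).steps,
    ((CTTerm.red_full_cps N).trans (CTTerm.Red.full_of_par h2)).steps⟩
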